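/- **Theorem 6.1 (Asymptotic one-way converse, shrinking-distortion regime).** All logarithms and entropies are in bits. *Source.* Let $M=(S,\mathcal A,\mathcal O,P,Z,r,b_0)$ be a finite POMDP, with a metric on $S$, in which agent $A$ acts by a stochastic finite-state controller $\pi_A$ with at most $m_A$ nodes. Let $h_t=(o_1,\dots,o_t)$ be the observation history, $P_M^{\pi_A}$ its law, and $b_h=P(s_t\mid h_t=h)$ the posterior belief; a history is *reachable* if it has positive probability. Fix an observation horizon $\ell(t)$, the number of future observations considered after a history of length $t$ (for instance a constant $L$, or $\max(L-t,0)$). For a stochastic finite-state controller $\pi$ let $P_M^\pi(\cdot\mid h)$ be the law of the next $\ell(t)$ observations when $\pi$, started in its initial node, is applied in $M$ from the belief $b_h$. Histories $h,h'$ are $m$-indistinguishable if they have the same $\ell$ and $P_M^\pi(\cdot\mid h)=P_M^\pi(\cdot\mid h')$ for every $\pi$ with at most $m$ nodes. Let $m_B\le m_A$, let $[h]_A,[h]_B$ be the classes for $m_A,m_B$, let $\mathcal Q_A,\mathcal Q_B$ be the sets of classes of reachable histories, and put $Q_t^A=[h_t]_A$, $Q_t^B=[h_t]_B$ (common-history coarsening).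 Assume $\mathcal Q_A$ is finite. *Intent.* $\mathrm{Intent}_A(h)=(b_h,\pi_A(\cdot\mid h),V^{\pi_A}(h))$, where $V$ is the expected reward over the next $\ell(t)$ steps, and $d_{\mathrm{intent}}\big((b,\pi,V),(b',\pi',V')\big)=\mathcal W_1(b,b')+\mathrm{TV}(\pi,\pi')+|V-V'|$. Let $c_M$ be the infimum of $d_{\mathrm{intent}}(\mathrm{Intent}_A(h),\mathrm{Intent}_A(h'))$ over reachable $h,h'$ with $[h]_A\ne[h']_A$ and $[h]_B=[h']_B$ ($c_M=\infty$ if there are none). *Protocols.* A protocol consists of encoders $M_t=E_t(h_t)$, $t\ge1$, with values in a finite set, an $m_B$-node stochastic controller of agent $B$ whose input at time $t$ is $Q_t^B$, and a map that resets the parameters of this controller (action distributions and node transitions) upon each message. It has rate $R$ over horizon $T$ if $H(M_t\mid M^{t-1})\le R$ for $1\le t\le T$. The receiver's intent at $h_t$ consists of its belief on $s_t$, its action distribution, and the value in $M$ of its current controller over the next $\ell(t)$ steps, all conditional on the received $(M^t,Q_B^t)$. The distortion $D_T$ is the average over $t=1,\dots,T$ of $\mathbb E\big[d_{\mathrm{intent}}(\mathrm{Intent}_A(h_t),\mathrm{Intent}_B(h_t))\big]$.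 *Assumptions.* (Intent measurability) $\mathrm{Intent}_A(h)=\mathrm{Intent}_A(h')$ for reachable $h,h'$ with $[h]_A=[h']_A$. (Quotient process regularity) the law of $(Q^A_{t+i},Q^B_{t+i})_{i\ge1}$ converges in total variation, as $t\to\infty$, to the law of a stationary ergodic process. (One-way observability) in the two-agent environment, $B$'s actions influence neither the state transitions nor the observations, which follow $P$ and $Z$ with $A$'s action. *Conclusion.* The entropy rates $h_A=\lim_T\frac1TH(Q_1^A,\dots,Q_T^A)$ and $h_B=\lim_T\frac1TH(Q_1^B,\dots,Q_T^B)$ exist. There is a sequence $\delta_T\to0$, independent of the protocols, such that every protocol with rate $R_T$ over horizon $T\ge1$ and $D_T\le\varepsilon_T$, with $\varepsilon_T'=2\varepsilon_T/c_M$ and $T\varepsilon_T'\le\frac12$, satisfies $$R_T\ \ge\ (h_A-h_B)-h(\varepsilon_T')-\varepsilon_T'\log|\mathcal Q_A|-\delta_T ,$$ where $h(\cdot)$ is the binary entropy function. Moreover, for every sequence of horizons $T\to\infty$ and protocols with rates $R_T$ and $D_T\le\varepsilon_T$ for which $\varepsilon_T'\to0$, one has $\liminf R_T\ge h_A-h_B$.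 If $|h_A-\log|\mathcal Q_A||\le\eta$ and $|h_B-\log|\mathcal Q_B||\le\eta$, then $h_A-h_B$ differs from $\log|\mathcal Q_A|-\log|\mathcal Q_B|$ by at most $2\eta$. -/

import Mathlib

open Filter Topology MeasureTheory
open scoped ENNReal

namespace SemComm

/-! ### Environments and controllers -/

/-- A finite POMDP (for finite `S`, `A`, `O`): transition kernel `P s a s'`, observation kernel
`Z s' a o`, reward `r s a`, initial belief `b₀`. -/
structure POMDP (S A O : Type) [Fintype S] [Fintype O] where
  P : S → A → stdSimplex ℝ S
  Z : S → A → stdSimplex ℝ O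
  r : S → A → ℝ
  b₀ : stdSimplex ℝ S

/-- The kernels of an environment in which two agents act at the same time:
`P s a b s'` and `Z s' a b o`, where `a` is the action of the sender and `b` that of the
receiver. -/
structure TwoAgentKernels (S A O : Type) [Fintype S] [Fintype O] where
  P : S → A → A → stdSimplex ℝ S
  Z : S → A → A → stdSimplex ℝ O

/-- One-way observability: the action of the receiver influences neither the state nor the
observation that the sender-side source is made of; both follow the POMDP `M`, driven by
the action of the sender alone. -/
def TwoAgentKernels.OneWay {S A O : Type} [Fintype S] [Fintype O]
    (J : TwoAgentKernels S A O) (M : POMDP S A O) : Prop :=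
  (∀ s a b, J.P s a b = M.P s a) ∧ (∀ s a b, J.Z s a b = M.Z s a)

/-- The parameters of an `m`-node stochastic finite-state controller with inputs in `X` and
actions in `A`: node transitions `α n x n'` and action distributions `β n a`. -/
structure FSCParams (m : ℕ) (X A : Type) [Fintype A] where
  α : Fin m → X → stdSimplex ℝ (Fin m)
  β : Fin m → stdSimplex ℝ A

/-- An `m`-node stochastic finite-state controller: parameters and an initial node. -/
structure FSC (m : ℕ) (X A : Type) [Fintype A] extends FSCParams m X A where
  init : Fin m

section Source

variable {S A O : Type} [Fintype S] [Fintype A] [Fintype O]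

/-- Expected total reward over the next `k` steps in `M`, started in state `s` after the history
`h`, when the actions come from a controller with action law `β` that is in node `n`, and that
moves from a node `n₁` according to `step n₁ o h₁` when the observation `o` arrives after the
history `h₁`.  Histories are lists with the most recent observation first. -/
noncomputable def runValue (M : POMDP S A O) {m : ℕ} (β : Fin m → stdSimplex ℝ A)
    (step : Fin m → O → List O → stdSimplex ℝ (Fin m)) :
    ℕ → List O → S → Fin m → ℝ
  | 0, _, _, _ => 0
  | k + 1, h, s, n =>
      ∑ a, β n a * (M.r s a + ∑ s', M.P s a s' * ∑ o, M.Z s' a o *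
        ∑ n', step n o h n' * runValue M β step k (o :: h) s' n')

/-- `futureProb M π w s n`: the probability that the next observations are `w` (in order of time),
when `M` is in state `s` and is driven by the controller `π`, which is in node `n`. -/
noncomputable def futureProb (M : POMDP S A O) {m : ℕ} (π : FSC m O A) :
    List O → S → Fin m → ℝ
  | [], _, _ => 1
  | o :: w, s, n =>
      ∑ a, π.β n a * ∑ s', M.P s a s' * (M.Z s' a o *
        ∑ n', π.α n o n' * futureProb M π w s' n')

/-- The data of the common-history source: the POMDP, the sender's policy (a controller
with `nodes` nodes) and the observation horizon: `window t` is the number of future observations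
(and rewards) that are looked at after a history of length `t`.  The choice `window t = L - t`
is a fixed terminal time `L`, the choice `window t = L` a receding horizon. -/
structure Source (S A O : Type) [Fintype S] [Fintype A] [Fintype O] where
  M : POMDP S A O
  nodes : ℕ
  policy : FSC nodes O A
  window : ℕ → ℕ

namespace Source

variable (src : Source S A O)

open Classical in
/-- The joint probability that the first `h.length` observations are `h` (most recent first), that
the current state is `s`, and that the sender's current node is `n`. -/
noncomputable def weight : List O → S → Fin src.nodes → ℝ
  | [], s, n => if n = src.policy.init then src.M.b₀ s else 0
  | o :: h, s', n' =>
      ∑ s, ∑ n, weight h s n *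
        ∑ a, src.policy.β n a * src.M.P s a s' * src.M.Z s' a o * src.policy.α n o n'

/-- `P_M^{π_A}(h)`, the probability of the history `h`. -/
noncomputable def prob (h : List O) : ℝ := ∑ s, ∑ n, src.weight h s n

/-- The histories that occur with positive probability. -/
def Reachable (h : List O) : Prop := 0 < src.prob h

/-- The posterior belief `b_h = P(s_t | h_t = h)`. -/
noncomputable def belief (h : List O) (s : S) : ℝ := (∑ n, src.weight h s n) / src.prob h

/-- The future observation law `P_M^π(O_{t+1:t+k} | h)` (`k = w.length`) of the controller `π`
applied after the history `h`; it depends on `h` only through the belief `b_h`. -/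
noncomputable def futureLaw {m : ℕ} (π : FSC m O A) (h : List O) (w : List O) : ℝ :=
  ∑ s, src.belief h s * futureProb src.M π w s π.init

/-- Bounded indistinguishability of histories for controllers with at most `m` nodes: all these
controllers produce the same law of the observations in the window.  (Equality of the laws is the
vanishing of their Wasserstein distance.) -/
def indist (m : ℕ) : Setoid (List O) where
  r h h' := src.window h.length = src.window h'.length ∧
    ∀ k ≤ m, ∀ π : FSC k O A, ∀ w : List O, w.length = src.window h.length →
      src.futureLaw π h w = src.futureLaw π h' w
  iseqv := by
    refine ⟨fun h => ⟨rfl, fun _ _ _ _ _ => rfl⟩, ?_, ?_⟩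
    · rintro h h' ⟨e, H⟩
      exact ⟨e.symm, fun k hk π w hw => (H k hk π w (hw.trans e.symm)).symm⟩
    · rintro h₁ h₂ h₃ ⟨e, H⟩ ⟨e', H'⟩
      exact ⟨e.trans e', fun k hk π w hw =>
        (H k hk π w hw).trans (H' k hk π w (hw.trans e))⟩

/-- The quotient classes of an agent with `m` nodes. -/
def QClass (m : ℕ) : Type := Quotient (src.indist m)

instance (m : ℕ) : MeasurableSpace (src.QClass m) := ⊤

/-- The class `[h]` of a history. -/
def cls (m : ℕ) (h : List O) : src.QClass m := Quotient.mk (src.indist m) h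

/-- The quotient alphabet of an agent with `m` nodes: the classes of the histories that occur. -/
def alphabet (m : ℕ) : Set (src.QClass m) := {q | ∃ h, src.Reachable h ∧ src.cls m h = q}

end Source

/-! ### Intent -/

/-- An intent: a belief on the states, an action distribution and a value. -/
structure Intent (S A : Type) where
  belief : S → ℝ
  policy : A → ℝ
  value : ℝ

/-- The 1-Wasserstein distance of two distributions on the finite metric space `S`. -/
noncomputable def wasserstein [MetricSpace S] (p q : S → ℝ) : ℝ :=
  sInf {c | ∃ γ : S → S → ℝ, (∀ x y, 0 ≤ γ x y) ∧ (∀ x, ∑ y, γ x y = p x) ∧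
    (∀ y, ∑ x, γ x y = q y) ∧ c = ∑ x, ∑ y, γ x y * dist x y}

/-- The total variation distance of two distributions on a finite set. -/
noncomputable def tv (p q : A → ℝ) : ℝ := (∑ a, |p a - q a|) / 2

/-- The intent distortion. -/
noncomputable def dIntent [MetricSpace S] (i j : Intent S A) : ℝ :=
  wasserstein i.belief j.belief + tv i.policy j.policy + |i.value - j.value|

namespace Source

variable (src : Source S A O)

/-- The sender's intent `(b_h, π_A(· | h), V^{π_A}(h))` at the history `h`. -/
noncomputable def intent (h : List O) : Intent S A where
  belief := src.belief h
  policy a := (∑ s, ∑ n, src.weight h s n * src.policy.β n a) / src.prob h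
  value := (∑ s, ∑ n, src.weight h s n *
    runValue src.M src.policy.β (fun n o _ => src.policy.α n o)
      (src.window h.length) h s n) / src.prob h

/-- Intent measurability: the sender's intent is constant on the classes of the sender. -/
def IntentMeasurable (mA : ℕ) : Prop :=
  ∀ h h', src.Reachable h → src.Reachable h' → src.cls mA h = src.cls mA h' →
    src.intent h = src.intent h'

/-- The separation constant `c_M`: the infimum of the intent distortion between histories in
different classes of the sender that lie in the same class of the receiver (it is `∞` if
there are no such histories). -/
noncomputable def cM [MetricSpace S] (mA mB : ℕ) : ℝ≥0∞ :=
  ⨅ (h : List O) (h' : List O) (_ : src.Reachable h) (_ : src.Reachable h')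
    (_ : src.cls mA h ≠ src.cls mA h') (_ : src.cls mB h = src.cls mB h'),
    ENNReal.ofReal (dIntent (src.intent h) (src.intent h'))

/-- `ε' = 2 ε / c_M`. -/
noncomputable def epsPrime [MetricSpace S] (mA mB : ℕ) (ε : ℝ) : ℝ≥0∞ :=
  2 * ENNReal.ofReal ε / src.cM mA mB

end Source

/-! ### Entropy, in bits -/

/-- `trace f h` lists the values of `f` at the successive nonempty initial segments of the
history `h`, i.e. at the times `h.length, …, 2, 1` (most recent first). -/
def trace {X : Type} (f : List O → X) : List O → List X
  | [] => []
  | o :: h => f (o :: h) :: trace f h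

open Classical in
/-- The probability of the event `B` when histories of length `T` have the law `p`. -/
noncomputable def eventProb (p : List O → ℝ) (T : ℕ) (B : List O → Prop) : ℝ :=
  ∑ ω : Fin T → O, if B (List.ofFn ω) then p (List.ofFn ω) else 0

open Classical in
/-- The Shannon entropy, in bits, of the random variable `X` on histories of length `T` with
law `p`. -/
noncomputable def entropy {X : Type} (p : List O → ℝ) (T : ℕ) (f : List O → X) : ℝ :=
  ∑ x ∈ Finset.univ.image (fun ω : Fin T → O => f (List.ofFn ω)),
    Real.negMulLog (eventProb p T (fun h => f h = x)) / Real.log 2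

/-- The conditional entropy `H(f | g) = H(f, g) - H(g)`. -/
noncomputable def condEntropy {X Y : Type} (p : List O → ℝ) (T : ℕ) (f : List O → X)
    (g : List O → Y) : ℝ :=
  entropy p T (fun h => (f h, g h)) - entropy p T g

/-- The binary entropy function in bits. -/
noncomputable def binEntropy₂ (x : ℝ) : ℝ := Real.binEntropy x / Real.log 2

namespace Source

variable (src : Source S A O)

/-- `H(Q_1, …, Q_T)` for the quotient process `Q_t = [h_t]` of an agent with `m` nodes. -/
noncomputable def blockEntropy (m T : ℕ) : ℝ := entropy src.prob T (trace (src.cls m))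

/-- `h` is the entropy rate of the quotient process of an agent with `m` nodes. -/
def HasEntropyRate (m : ℕ) (h : ℝ) : Prop :=
  Tendsto (fun T : ℕ => src.blockEntropy m T / T) atTop (𝓝 h)

/-- Quotient process regularity: the joint quotient process `(Q_t^A, Q_t^B)` converges, in
total variation, to a stationary ergodic process.  That is, for some shift-invariant ergodic
probability measure `μ` on sequences, the law of `(Q_{t+1}, …, Q_{t+k})` differs from the
corresponding marginal of `μ` by at most `δ t` on every event, for every `k`, with `δ t → 0`. -/
def Regular (mA mB : ℕ) : Prop :=
  ∃ μ : Measure (ℕ → src.QClass mA × src.QClass mB), IsProbabilityMeasure μ ∧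
    Ergodic (fun (x : ℕ → src.QClass mA × src.QClass mB) (n : ℕ) => x (n + 1)) μ ∧
    ∃ δ : ℕ → ℝ, Tendsto δ atTop (𝓝 0) ∧
      ∀ (t k : ℕ) (B : Set (List (src.QClass mA × src.QClass mB))),
        |eventProb src.prob (t + k)
            (fun h => ((trace (fun g => (src.cls mA g, src.cls mB g)) h).take k).reverse ∈ B)
          - (μ {x | List.ofFn (fun i : Fin k => x i) ∈ B}).toReal| ≤ δ t

end Source

/-! ### Communication protocols -/

/-- A protocol.  At time `t ≥ 1` the encoder sends a message that is a function of the
history `h_t` (hence of `t`).  The decoder is an `m`-node controller whose inputs, in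
`X`, are the receiver's side information; each received message reconfigures its parameters, but
neither its number of nodes nor its current node. -/
structure Protocol (K m : ℕ) (X A O : Type) [Fintype A] where
  encoder : List O → Fin K
  decoder : FSC m X A
  update : Fin K → FSCParams m X A

/-- The decoder's parameters in force after the history `h`. -/
def Protocol.params {K m : ℕ} {X : Type} (p : Protocol K m X A O) : List O → FSCParams m X A
  | [] => p.decoder.toFSCParams
  | o :: h => p.update (p.encoder (o :: h))

namespace Source

variable (src : Source S A O) (J : TwoAgentKernels S A O) {K mB : ℕ}
  (p : Protocol K mB (src.QClass mB) A O)

open Classical in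
/-- The joint probability, when both agents act in the environment `J`, of the history `h`, the
state `s`, the sender's node `n` and the receiver's node `l`.  The receiver's controller, with its
current parameters, is driven by the receiver's quotient class of the history. -/
noncomputable def jointWeight : List O → S → Fin src.nodes → Fin mB → ℝ
  | [], s, n, l => if n = src.policy.init ∧ l = p.decoder.init then src.M.b₀ s else 0
  | o :: h, s', n', l' =>
      ∑ s, ∑ n, ∑ l, jointWeight h s n l *
        ∑ a, ∑ b, src.policy.β n a * (p.params h).β l b * J.P s a b s' * J.Z s' a b o *
          src.policy.α n o n' * (p.params (o :: h)).α l (src.cls mB (o :: h)) l'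

/-- The probability of the history `h` under the protocol. -/
noncomputable def jointProb (h : List O) : ℝ := ∑ s, ∑ n, ∑ l, src.jointWeight J p h s n l

/-- What the receiver has been given up to time `t`: the messages `M_1, …, M_t` and its own
quotient classes `Q_1^B, …, Q_t^B`. -/
def info (h : List O) : List (Fin K × src.QClass mB) :=
  trace (fun g => (p.encoder g, src.cls mB g)) h

open Classical in
/-- The conditional expectation of `F h_t s_t n_t^B` given that the receiver's information is the
one that it has at the history `h`. -/
noncomputable def condInfo (F : List O → S → Fin mB → ℝ) (h : List O) : ℝ :=
  (∑ ω : Fin h.length → O, if src.info p (List.ofFn ω) = src.info p h then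
      ∑ s, ∑ n, ∑ l, src.jointWeight J p (List.ofFn ω) s n l * F (List.ofFn ω) s l else 0) /
    eventProb (src.jointProb J p) h.length (fun g => src.info p g = src.info p h)

open Classical in
/-- The receiver's intent realized at the history `h`: its belief on the state, its action
distribution, and the value in `M` of its controller (with the current parameters), given the
messages and the side information that it has received. -/
noncomputable def receiverIntent (h : List O) : Intent S A where
  belief s := src.condInfo J p (fun _ s' _ => if s' = s then 1 else 0) h
  policy a := src.condInfo J p (fun g _ l => (p.params g).β l a) h
  value := src.condInfo J p (fun g s l =>
    runValue src.M (p.params g).β (fun l o g' => (p.params g).α l (src.cls mB (o :: g')))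
      (src.window g.length) g s l) h

/-- The expected intent distortion of the protocol, averaged over the times `1, …, T`. -/
noncomputable def distortion [MetricSpace S] (T : ℕ) : ℝ :=
  (∑ t ∈ Finset.Icc 1 T, ∑ ω : Fin t → O, src.jointProb J p (List.ofFn ω) *
    dIntent (src.intent (List.ofFn ω)) (src.receiverIntent J p (List.ofFn ω))) / T

/-- The protocol has rate at most `R` bits per step over the horizon `T`:
`H(M_t | M_1, …, M_{t-1}) ≤ R` for `t = 1, …, T`.  (This holds in particular if the number of
messages is at most `2 ^ R`.) -/
def HasRate (T : ℕ) (R : ℝ) : Prop :=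
  ∀ t ∈ Finset.Icc 1 T,
    condEntropy (src.jointProb J p) t p.encoder (fun h => trace p.encoder h.tail) ≤ R

end Source

end Source

end SemComm

open SemComm

/-!
The converse is an information-theoretic count of what the receiver must learn. Let `Q_A^T`, `Q_B^T`
be the class trajectories up to the horizon `T`, and let the receiver's information consist of the
messages `M^T` and of `Q_B^T`. Then

`H(Q_A^T) ≤ H(Q_A^T | M^T, Q_B^T) + H(M^T) + H(Q_B^T)`,

and `H(M^T) ≤ T R` by the chain rule (`entropy_trace_le_mul`). So the excess of `H(Q_A^T)` over
`H(Q_B^T)` is paid for by the rate, up to the equivocation `H(Q_A^T | M^T, Q_B^T)`.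

Small distortion makes the equivocation small. The receiver guesses a reachable history which lies
in its own class and whose intent is within `c_M / 2` of the intent of the receiver. By the triangle
inequality for the intent distortion the guess has the right sender class whenever the true intent
is also within `c_M / 2` (`Source.guess_eq`); by Markov's inequality it fails at time `t` with
probability at most `2 / c_M` times the expected distortion (`Source.eventProb_guess_ne_le`). Fano's
inequality at each time (`condEntropy_le_fano`), always with the parameter `θ = ε'` instead of the
error probability of that time, is affine in the error probability and can be averaged over time
without any concavity argument. The result is `Source.blockEntropy_sub_div_le`. That `c_M` is
positive (`Source.cM_pos`) matters when `ε = 0`, where `ε' = 2 ε / c_M` would vanish by convention even for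
`c_M = 0`: equal beliefs and equal receiver classes force equal sender classes, and there are only
finitely many intents.

The entropy rates exist because the laws of the blocks after time `t` converge as `t → ∞`: the
limits of the block entropies are subadditive in the block length, so Fekete's lemma applies, and
total variation convergence bounds the difference to the block entropies of the process itself by
`O(t) + o(1) * k` for a block of length `k` after time `t` (`exists_tendsto_entropy_div`).
The sequence `δ_T` is the error in
`(H(Q_A^T) - H(Q_B^T)) / T → h_A - h_B`, and does not see the protocol.

The inequalities for entropies all follow from Gibbs' inequality for conditional laws,
`condEntropy_le_expect`.
-/

namespace SemComm

/-! ### Laws of histories and expectations -/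

section HistoryLaw

variable {O X Y Z : Type} [Fintype O] {p : List O → ℝ}

/-- A consistent family of probability laws on the histories of each length: `p h` is the
probability that the first `h.length` observations are `h` (most recent first). -/
structure IsHistoryLaw (p : List O → ℝ) : Prop where
  nonneg : ∀ h, 0 ≤ p h
  nil : p [] = 1
  sum_cons : ∀ h, ∑ o, p (o :: h) = p h

/-- The expectation of `F` over the histories of length `T` with law `p`. -/
noncomputable def expect (p : List O → ℝ) (T : ℕ) (F : List O → ℝ) : ℝ :=
  ∑ ω : Fin T → O, p (List.ofFn ω) * F (List.ofFn ω)

lemma sum_ofFn_succ (T : ℕ) (F : List O → ℝ) :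
    ∑ ω : Fin (T + 1) → O, F (List.ofFn ω) = ∑ ω : Fin T → O, ∑ o, F (o :: List.ofFn ω) := by
  rw [← (Fin.consEquiv (fun _ : Fin (T + 1) => O)).sum_comp, Fintype.sum_prod_type_right]
  simp [Fin.consEquiv, List.ofFn_succ]

lemma expect_mono (hp : IsHistoryLaw p) {T : ℕ} {F G : List O → ℝ}
    (h : ∀ l, l.length = T → 0 < p l → F l ≤ G l) : expect p T F ≤ expect p T G := by
  refine Finset.sum_le_sum fun ω _ => ?_
  rcases (hp.nonneg (List.ofFn ω)).eq_or_lt with h0 | h0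
  · simp [← h0]
  · exact mul_le_mul_of_nonneg_left (h _ (by simp) h0) h0.le

lemma expect_congr (hp : IsHistoryLaw p) {T : ℕ} {F G : List O → ℝ}
    (h : ∀ l, l.length = T → 0 < p l → F l = G l) : expect p T F = expect p T G :=
  le_antisymm (expect_mono hp fun l a b => (h l a b).le)
    (expect_mono hp fun l a b => (h l a b).ge)

lemma expect_tail (hp : IsHistoryLaw p) (T : ℕ) (F : List O → ℝ) :
    expect p (T + 1) (fun h => F h.tail) = expect p T F := by
  rw [expect, sum_ofFn_succ T (fun l => p l * F l.tail)]
  simp only [List.tail_cons, ← Finset.sum_mul, hp.sum_cons]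
  rfl

lemma expect_const (hp : IsHistoryLaw p) (T : ℕ) (c : ℝ) : expect p T (fun _ => c) = c := by
  induction T with
  | zero => simp [expect, hp.nil]
  | succ T ih => exact (expect_tail hp T (fun _ => c)).trans ih

lemma expect_add (T : ℕ) (F G : List O → ℝ) :
    expect p T (fun h => F h + G h) = expect p T F + expect p T G := by
  simp [expect, mul_add, Finset.sum_add_distrib]

lemma expect_sub (T : ℕ) (F G : List O → ℝ) :
    expect p T (fun h => F h - G h) = expect p T F - expect p T G := by
  simp [expect, mul_sub, Finset.sum_sub_distrib]

lemma expect_neg (T : ℕ) (F : List O → ℝ) :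
    expect p T (fun h => - F h) = - expect p T F := by
  simp [expect]

lemma expect_mul_const (T : ℕ) (F : List O → ℝ) (c : ℝ) :
    expect p T (fun h => F h * c) = expect p T F * c := by
  simp [expect, Finset.sum_mul, mul_assoc]

lemma expect_nonneg (hp : IsHistoryLaw p) {T : ℕ} {F : List O → ℝ}
    (h : ∀ l, l.length = T → 0 < p l → 0 ≤ F l) : 0 ≤ expect p T F := by
  rw [← expect_const hp T 0]
  exact expect_mono hp h

open Classical in
lemma eventProb_eq_expect (T : ℕ) (B : List O → Prop) :
    eventProb p T B = expect p T (fun h => if B h then 1 else 0) := by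
  simp [eventProb, expect]

lemma eventProb_tail (hp : IsHistoryLaw p) (T : ℕ) (B : List O → Prop) :
    eventProb p (T + 1) (fun h => B h.tail) = eventProb p T B := by
  classical
  simp only [eventProb_eq_expect]
  exact expect_tail hp T (fun h => if B h then 1 else 0)

lemma eventProb_mono (hp : IsHistoryLaw p) {T : ℕ} {B C : List O → Prop}
    (h : ∀ l, l.length = T → 0 < p l → B l → C l) : eventProb p T B ≤ eventProb p T C := by
  classical
  rw [eventProb_eq_expect, eventProb_eq_expect]
  refine expect_mono hp fun l hl h0 => ?_
  by_cases hB : B l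
  · simp [hB, h l hl h0 hB]
  · simp only [hB, if_false]
    split_ifs <;> norm_num

lemma eventProb_nonneg (hp : IsHistoryLaw p) (T : ℕ) (B : List O → Prop) :
    0 ≤ eventProb p T B := by
  classical
  rw [eventProb_eq_expect]
  exact expect_nonneg hp fun l _ _ => by split_ifs <;> norm_num

lemma eventProb_le_one (hp : IsHistoryLaw p) (T : ℕ) (B : List O → Prop) :
    eventProb p T B ≤ 1 := by
  classical
  rw [eventProb_eq_expect]
  refine (expect_mono (G := fun _ => 1) hp fun l _ _ => ?_).trans (expect_const hp T 1).le
  split_ifs <;> norm_num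

lemma le_eventProb (hp : IsHistoryLaw p) {T : ℕ} {B : List O → Prop} {h : List O}
    (hT : h.length = T) (hB : B h) : p h ≤ eventProb p T B := by
  classical
  subst hT
  have := Finset.single_le_sum (f := fun ω : Fin h.length → O =>
    if B (List.ofFn ω) then p (List.ofFn ω) else 0)
    (fun ω _ => by split_ifs <;> [exact hp.nonneg _; exact le_rfl])
    (Finset.mem_univ h.get)
  simpa [eventProb, hB] using this

lemma expect_comp_eq_sum (hp : IsHistoryLaw p) {T : ℕ} {f : List O → X} {F : Finset X}
    (hF : ∀ h, h.length = T → 0 < p h → f h ∈ F) (G : X → ℝ) :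
    expect p T (fun h => G (f h)) = ∑ x ∈ F, eventProb p T (fun h => f h = x) * G x := by
  classical
  simp only [eventProb, Finset.sum_mul]
  rw [Finset.sum_comm, expect]
  refine Finset.sum_congr rfl fun ω _ => ?_
  simp only [ite_mul, zero_mul]
  rcases (hp.nonneg (List.ofFn ω)).eq_or_lt with h0 | h0
  · simp [← h0]
  · rw [Finset.sum_ite_eq, if_pos (hF _ (by simp) h0)]

lemma eventProb_mem_eq_sum {T : ℕ} {f : List O → X} (B : Finset X) :
    eventProb p T (fun h => f h ∈ B) = ∑ x ∈ B, eventProb p T (fun h => f h = x) := by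
  classical
  simp only [eventProb]
  rw [Finset.sum_comm]
  refine Finset.sum_congr rfl fun ω _ => ?_
  rw [Finset.sum_ite_eq]
  split_ifs <;> rfl

/-! ### Entropy -/

/-- The entropy may be summed over any finite set that carries the random variable. -/
lemma entropy_eq_sum (hp : IsHistoryLaw p) {T : ℕ} {f : List O → X} {F : Finset X}
    (hF : ∀ h, h.length = T → 0 < p h → f h ∈ F) :
    entropy p T f =
      ∑ x ∈ F, Real.negMulLog (eventProb p T (fun h => f h = x)) / Real.log 2 := by
  classical
  have key : ∀ F' : Finset X, (∀ h, h.length = T → 0 < p h → f h ∈ F') →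
      ∑ x ∈ F', Real.negMulLog (eventProb p T (fun h => f h = x)) / Real.log 2 =
      expect p T (fun h => -Real.log (eventProb p T (fun g => f g = f h)) / Real.log 2) := by
    intro F' hF'
    rw [expect_comp_eq_sum hp hF'
      (fun x => -Real.log (eventProb p T (fun g => f g = x)) / Real.log 2)]
    refine Finset.sum_congr rfl fun x _ => ?_
    rw [Real.negMulLog]
    ring
  rw [key F hF, ← key]
  · rfl
  · intro h hT _
    subst hT
    exact Finset.mem_image.2 ⟨h.get, Finset.mem_univ _, by simp⟩

/-- The entropy is the expected surprisal. -/
lemma entropy_eq_expect (hp : IsHistoryLaw p) (T : ℕ) (f : List O → X) :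
    entropy p T f = expect p T (fun h => -Real.logb 2 (eventProb p T (fun g => f g = f h))) := by
  classical
  have hF : ∀ h : List O, h.length = T → 0 < p h →
      f h ∈ Finset.univ.image (fun ω : Fin T → O => f (List.ofFn ω)) := by
    intro h hT _
    subst hT
    exact Finset.mem_image.2 ⟨h.get, Finset.mem_univ _, by simp⟩
  rw [entropy_eq_sum hp hF,
    expect_comp_eq_sum hp hF (fun x => -Real.logb 2 (eventProb p T (fun g => f g = x)))]
  refine Finset.sum_congr rfl fun x _ => ?_
  rw [Real.negMulLog, Real.logb]
  ring

lemma eventProb_self_pos (hp : IsHistoryLaw p) {T : ℕ} (f : List O → X) {h : List O}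
    (hT : h.length = T) (h0 : 0 < p h) : 0 < eventProb p T (fun g => f g = f h) :=
  h0.trans_le (le_eventProb hp hT rfl)

lemma entropy_nonneg (hp : IsHistoryLaw p) (T : ℕ) (f : List O → X) : 0 ≤ entropy p T f := by
  rw [entropy_eq_expect hp]
  refine expect_nonneg hp fun h hT h0 => ?_
  have := Real.logb_nonpos (b := 2) (by norm_num) (eventProb_nonneg hp T (fun g => f g = f h))
    (eventProb_le_one hp _ _)
  linarith

/-- A random variable that is determined by another one has the smaller entropy. -/
lemma entropy_le_of_determined (hp : IsHistoryLaw p) {T : ℕ} {f : List O → X} {g : List O → Y}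
    (H : ∀ h h', h.length = T → h'.length = T → g h = g h' → f h = f h') :
    entropy p T f ≤ entropy p T g := by
  rw [entropy_eq_expect hp, entropy_eq_expect hp]
  refine expect_mono hp fun h hT h0 => neg_le_neg ?_
  exact Real.logb_le_logb_of_le (by norm_num) (eventProb_self_pos hp g hT h0)
    (eventProb_mono hp fun l hl _ e => H l h hl hT e)

lemma entropy_congr (hp : IsHistoryLaw p) {T : ℕ} {f : List O → X} {g : List O → Y}
    (H : ∀ h h', h.length = T → h'.length = T → (f h = f h' ↔ g h = g h')) :
    entropy p T f = entropy p T g :=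
  le_antisymm (entropy_le_of_determined hp fun h h' a b => (H h h' a b).2)
    (entropy_le_of_determined hp fun h h' a b => (H h h' a b).1)

lemma entropy_tail (hp : IsHistoryLaw p) (T : ℕ) (f : List O → X) :
    entropy p (T + 1) (fun h => f h.tail) = entropy p T f := by
  rw [entropy_eq_expect hp, entropy_eq_expect hp,
    ← expect_tail hp T (fun h => -Real.logb 2 (eventProb p T (fun g => f g = f h)))]
  congr 1
  funext h
  rw [← eventProb_tail hp T]

lemma entropy_drop (hp : IsHistoryLaw p) (T n : ℕ) (f : List O → X) :
    entropy p (T + n) (fun h => f (h.drop n)) = entropy p T f := by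
  induction n with
  | zero => rfl
  | succ n ih =>
    rw [← ih, ← entropy_tail hp (T + n) (fun h => f (h.drop n))]
    congr 1
    funext h
    rw [List.drop_tail]

lemma entropy_const (hp : IsHistoryLaw p) (T : ℕ) (c : X) : entropy p T (fun _ => c) = 0 := by
  classical
  rw [entropy_eq_expect hp]
  simp [eventProb_eq_expect, expect_const hp]

/-- Gibbs' inequality for conditional laws: the conditional entropy is at most the cross entropy
with respect to any conditional subprobability `q`. Submodularity of the entropy, Fano's
inequality and the bound by the logarithm of the alphabet size are special cases. -/
lemma condEntropy_le_expect (hp : IsHistoryLaw p) {T : ℕ} {f : List O → X} {g : List O → Y}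
    {F : Finset X} (hF : ∀ h, h.length = T → 0 < p h → f h ∈ F) {q : X → Y → ℝ}
    (hq0 : ∀ x y, 0 ≤ q x y) (hq1 : ∀ y, ∑ x ∈ F, q x y ≤ 1)
    (hq : ∀ h, h.length = T → 0 < p h → 0 < q (f h) (g h)) :
    condEntropy p T f g ≤ expect p T (fun h => -Real.logb 2 (q (f h) (g h))) := by
  classical
  set Pxy : X × Y → ℝ := fun z => eventProb p T (fun h => (f h, g h) = z) with hPxy
  set Py : Y → ℝ := fun y => eventProb p T (fun h => g h = y) with hPy
  set D : Finset Y := Finset.univ.image (fun ω : Fin T → O => g (List.ofFn ω)) with hD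
  have hgD : ∀ h : List O, h.length = T → 0 < p h → g h ∈ D := by
    intro h hT _
    subst hT
    exact Finset.mem_image.2 ⟨h.get, Finset.mem_univ _, by simp⟩
  have hfg : ∀ h : List O, h.length = T → 0 < p h → (f h, g h) ∈ F ×ˢ D :=
    fun h a b => Finset.mem_product.2 ⟨hF h a b, hgD h a b⟩
  have hl2 : 0 < Real.log 2 := Real.log_pos (by norm_num)
  have h1 : expect p T (fun h => Py (g h) * q (f h) (g h) / Pxy (f h, g h)) ≤ 1 := by
    rw [expect_comp_eq_sum hp hfg (fun z => Py z.2 * q z.1 z.2 / Pxy z)]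
    calc ∑ z ∈ F ×ˢ D, Pxy z * (Py z.2 * q z.1 z.2 / Pxy z)
        ≤ ∑ z ∈ F ×ˢ D, Py z.2 * q z.1 z.2 := by
          refine Finset.sum_le_sum fun z _ => ?_
          have hz : 0 ≤ Py z.2 * q z.1 z.2 := mul_nonneg (eventProb_nonneg hp _ _) (hq0 _ _)
          rcases eq_or_ne (Pxy z) 0 with h0 | h0
          · simpa [h0] using hz
          · rw [mul_div_cancel₀ _ h0]
      _ = ∑ y ∈ D, Py y * ∑ x ∈ F, q x y := by
          rw [Finset.sum_product_right]
          simp only [Finset.mul_sum]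
      _ ≤ ∑ y ∈ D, Py y * 1 := by
          gcongr with y _
          · exact eventProb_nonneg hp _ _
          · exact hq1 y
      _ = 1 := by
          rw [← expect_comp_eq_sum hp hgD (fun _ => (1 : ℝ)), expect_const hp]
  have h2 : expect p T (fun h => (1 - Py (g h) * q (f h) (g h) / Pxy (f h, g h)) / Real.log 2) ≤
      expect p T (fun h => Real.logb 2 (Pxy (f h, g h)) - Real.logb 2 (Py (g h))
        - Real.logb 2 (q (f h) (g h))) := by
    refine expect_mono hp fun h hT h0 => ?_
    have a1 : 0 < Pxy (f h, g h) := eventProb_self_pos hp (fun g' => (f g', g g')) hT h0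
    have a2 : 0 < Py (g h) := eventProb_self_pos hp g hT h0
    have a3 := hq h hT h0
    have a4 := Real.log_le_sub_one_of_pos (div_pos (mul_pos a2 a3) a1)
    rw [Real.log_div (mul_pos a2 a3).ne' a1.ne', Real.log_mul a2.ne' a3.ne'] at a4
    simp only [Real.logb, ← sub_div]
    refine div_le_div_of_nonneg_right ?_ hl2.le
    linarith
  have h3 : 0 ≤ expect p T
      (fun h => (1 - Py (g h) * q (f h) (g h) / Pxy (f h, g h)) / Real.log 2) := by
    simp only [div_eq_mul_inv _ (Real.log 2)]
    rw [expect_mul_const, expect_sub, expect_const hp]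
    exact mul_nonneg (by linarith) (inv_nonneg.2 hl2.le)
  rw [condEntropy, entropy_eq_expect hp, entropy_eq_expect hp]
  rw [expect_sub, expect_sub] at h2
  simp only [expect_neg]
  linarith

/-- Conditioning on more reduces the entropy. -/
lemma condEntropy_prod_le (hp : IsHistoryLaw p) (T : ℕ) (f : List O → X) (g : List O → Y)
    (k : List O → Z) :
    condEntropy p T f (fun h => (g h, k h)) ≤ condEntropy p T f k := by
  classical
  have hF : ∀ h : List O, h.length = T → 0 < p h →
      f h ∈ Finset.univ.image (fun ω : Fin T → O => f (List.ofFn ω)) := by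
    intro h hT _
    subst hT
    exact Finset.mem_image.2 ⟨h.get, Finset.mem_univ _, by simp⟩
  refine (condEntropy_le_expect hp hF
    (q := fun x y => eventProb p T (fun h => (f h, k h) = (x, y.2)) /
      eventProb p T (fun h => k h = y.2)) (fun x y => ?_) (fun y => ?_) fun h hT h0 => ?_).trans
    (le_of_eq ?_)
  · exact div_nonneg (eventProb_nonneg hp _ _) (eventProb_nonneg hp _ _)
  · rw [← Finset.sum_div]
    refine div_le_one_of_le₀ ?_ (eventProb_nonneg hp _ _)
    simp only [eventProb]
    rw [Finset.sum_comm]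
    refine Finset.sum_le_sum fun ω _ => ?_
    by_cases hk : k (List.ofFn ω) = y.2
    · simp [hk]
    · simp [hk]
  · exact div_pos (eventProb_self_pos hp (fun g => (f g, k g)) hT h0)
      (eventProb_self_pos hp k hT h0)
  · rw [condEntropy, entropy_eq_expect hp, entropy_eq_expect hp, ← expect_sub]
    refine expect_congr hp fun h hT h0 => ?_
    rw [Real.logb_div (eventProb_self_pos hp (fun g => (f g, k g)) hT h0).ne'
      (eventProb_self_pos hp k hT h0).ne']
    ring

lemma entropy_prod_le (hp : IsHistoryLaw p) (T : ℕ) (f : List O → X) (g : List O → Y) :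
    entropy p T (fun h => (f h, g h)) ≤ entropy p T f + entropy p T g := by
  have h := condEntropy_prod_le hp T f g (fun _ => ())
  rw [condEntropy, condEntropy, entropy_const hp,
    entropy_congr hp (g := fun h => (f h, g h)) (fun h h' _ _ => by simp),
    entropy_congr hp (f := fun h => (g h, ())) (g := g) (fun h h' _ _ => by simp),
    entropy_congr hp (f := fun h => (f h, ())) (g := f) (fun h h' _ _ => by simp)] at h
  linarith

/-- The entropy is at most the logarithm of the number of values. -/
lemma entropy_le_logb_card (hp : IsHistoryLaw p) {T : ℕ} {f : List O → X} {F : Finset X}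
    (hF : ∀ h, h.length = T → 0 < p h → f h ∈ F) (hne : F.Nonempty) :
    entropy p T f ≤ Real.logb 2 F.card := by
  have hc : (0 : ℝ) < F.card := by exact_mod_cast hne.card_pos
  have h := condEntropy_le_expect hp hF (g := fun _ => ()) (q := fun _ _ => (F.card : ℝ)⁻¹)
    (fun _ _ => by positivity)
    (fun _ => by simp [mul_inv_cancel₀ hc.ne']) (fun _ _ _ => by positivity)
  rw [condEntropy, entropy_const hp, expect_const hp, Real.logb_inv,
    entropy_congr hp (f := fun h => (f h, ())) (g := f) (fun h h' _ _ => by simp)] at h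
  linarith

/-- Fano's inequality, with a parameter `θ` in place of the error probability: the guess `φ (g h)`
of `f h` has conditional probability `1 - θ`, and `θ` is spread evenly over the alphabet. -/
lemma condEntropy_le_fano (hp : IsHistoryLaw p) {T : ℕ} {f : List O → X} {g : List O → Y}
    {F : Finset X} (hF : ∀ h, h.length = T → 0 < p h → f h ∈ F) (φ : Y → X) {θ : ℝ}
    (h0 : 0 ≤ θ) (h1 : θ < 1)
    (hθ : θ = 0 → eventProb p T (fun h => f h ≠ φ (g h)) = 0) :
    condEntropy p T f g ≤ -Real.logb 2 (1 - θ)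
      + eventProb p T (fun h => f h ≠ φ (g h)) *
        (Real.logb 2 (1 - θ) - Real.logb 2 θ + Real.logb 2 F.card) := by
  classical
  have hpos : ∀ h, h.length = T → 0 < p h → f h ≠ φ (g h) → 0 < θ := by
    intro h hT hh hne
    refine h0.lt_of_ne fun e => ?_
    have := le_eventProb (B := fun h => f h ≠ φ (g h)) hp hT hne
    rw [hθ e.symm] at this
    linarith
  have hcard : ∀ h, h.length = T → 0 < p h → (0 : ℝ) < F.card := fun h hT hh => by
    exact_mod_cast Finset.card_pos.2 ⟨_, hF h hT hh⟩
  refine (condEntropy_le_expect hp hF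
    (q := fun x y => (if x = φ y then 1 - θ else 0) + (if x = φ y then 0 else θ / F.card))
    (fun x y => ?_) (fun y => ?_) (fun h hT hh => ?_)).trans ?_
  · have : 0 ≤ θ / F.card := by positivity
    split_ifs <;> linarith
  · rw [Finset.sum_add_distrib]
    have e1 : ∑ x ∈ F, (if x = φ y then 1 - θ else 0) ≤ 1 - θ := by
      rw [Finset.sum_ite_eq']
      split_ifs <;> linarith
    have e2 : ∑ x ∈ F, (if x = φ y then 0 else θ / F.card) ≤ θ := by
      calc _ ≤ ∑ x ∈ F, θ / F.card := by
            refine Finset.sum_le_sum fun x _ => ?_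
            split_ifs
            · positivity
            · exact le_rfl
        _ ≤ θ := by
            rw [Finset.sum_const, nsmul_eq_mul]
            rcases eq_or_ne (F.card : ℝ) 0 with hc | hc
            · simpa [hc] using h0
            · rw [mul_div_cancel₀ _ hc]
    linarith
  · by_cases hc : f h = φ (g h)
    · simp only [hc, if_true]
      linarith
    · simp only [hc, if_false]
      have := hpos h hT hh hc
      have := hcard h hT hh
      positivity
  · rw [eventProb_eq_expect, ← expect_mul_const]
    conv_rhs => rw [← expect_const hp T (-Real.logb 2 (1 - θ)), ← expect_add]
    refine expect_mono hp fun h hT hh => ?_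
    by_cases hc : f h = φ (g h)
    · simp [hc]
    · simp only [hc, if_false, ne_eq, not_false_eq_true, if_true, zero_add]
      rw [Real.logb_div (hpos h hT hh hc).ne' (hcard h hT hh).ne']
      linarith

end HistoryLaw

/-! ### Continuity of the entropy -/

section Continuity

lemma negMulLog_add_le {a b : ℝ} (ha : 0 ≤ a) (hb : 0 ≤ b) :
    Real.negMulLog (a + b) ≤ Real.negMulLog a + Real.negMulLog b := by
  have key : ∀ {x y : ℝ}, 0 ≤ x → 0 ≤ y → x * Real.log x ≤ x * Real.log (x + y) := by
    intro x y hx hy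
    rcases hx.eq_or_lt with rfl | hx
    · simp
    · exact mul_le_mul_of_nonneg_left (Real.log_le_log hx (by linarith)) hx.le
  have h1 := key ha hb
  have h2 := key hb ha
  rw [add_comm b a] at h2
  simp only [Real.negMulLog]
  linarith

lemma negMulLog_sub_le_add {a b : ℝ} (ha : 0 ≤ a) (hb : 0 ≤ b) (hab : a + b ≤ 1) :
    Real.negMulLog a - b ≤ Real.negMulLog (a + b) := by
  have hlog : b * Real.log (a + b) ≤ 0 :=
    mul_nonpos_of_nonneg_of_nonpos hb (Real.log_nonpos (by linarith) hab)
  rcases ha.eq_or_lt with rfl | ha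
  · simp only [Real.negMulLog, zero_add] at *
    linarith
  · have h1 := Real.log_le_sub_one_of_pos (div_pos (by linarith : 0 < a + b) ha)
    rw [Real.log_div (by linarith) ha.ne'] at h1
    have h2 := mul_le_mul_of_nonneg_left h1 ha.le
    have h3 : a * ((a + b) / a - 1) = b := by
      field_simp
      ring
    rw [h3] at h2
    simp only [Real.negMulLog]
    linarith

lemma abs_negMulLog_sub_le {a b : ℝ} (ha : 0 ≤ a) (hb : 0 ≤ b) (ha1 : a ≤ 1) (hb1 : b ≤ 1) :
    |Real.negMulLog a - Real.negMulLog b| ≤ Real.negMulLog |a - b| + |a - b| := by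
  wlog h : a ≤ b generalizing a b
  · rw [abs_sub_comm, abs_sub_comm a b]
    exact this hb ha hb1 ha1 (by linarith)
  have h1 := negMulLog_add_le ha (sub_nonneg.2 h)
  have h2 := negMulLog_sub_le_add ha (sub_nonneg.2 h) (by linarith)
  have h3 := Real.negMulLog_nonneg (sub_nonneg.2 h) (by linarith)
  rw [add_sub_cancel] at h1 h2
  rw [abs_sub_comm a b, abs_of_nonneg (sub_nonneg.2 h), abs_le]
  constructor <;> linarith

/-- The entropy functional is almost Lipschitz for the total variation distance, with a constant
proportional to the logarithm of the size of the alphabet. -/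
lemma abs_sum_negMulLog_sub_le {X : Type} {F : Finset X} {a b : X → ℝ}
    (ha : ∀ x, 0 ≤ a x) (hb : ∀ x, 0 ≤ b x) (ha1 : ∀ x, a x ≤ 1) (hb1 : ∀ x, b x ≤ 1) {δ : ℝ}
    (h : ∀ B ⊆ F, |∑ x ∈ B, a x - ∑ x ∈ B, b x| ≤ δ) :
    |∑ x ∈ F, Real.negMulLog (a x) - ∑ x ∈ F, Real.negMulLog (b x)|
      ≤ 2 * δ * Real.log F.card + 1 := by
  classical
  rcases F.eq_empty_or_nonempty with rfl | hne
  · simp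
  have hc : (0 : ℝ) < F.card := by exact_mod_cast hne.card_pos
  -- The tangent line of `negMulLog` at `1 / F.card` bounds the sum over the differences.
  have htan : ∀ x, Real.negMulLog |a x - b x| ≤
      |a x - b x| * Real.log F.card + (F.card : ℝ)⁻¹ - |a x - b x| := by
    intro x
    rcases (abs_nonneg (a x - b x)).eq_or_lt with h0 | h0
    · rw [← h0]
      simp
    · have h1 := Real.log_le_sub_one_of_pos (inv_pos.2 (mul_pos hc h0))
      rw [Real.log_inv, Real.log_mul hc.ne' h0.ne'] at h1
      have h2 := mul_le_mul_of_nonneg_left h1 h0.le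
      have h3 : |a x - b x| * (((F.card : ℝ) * |a x - b x|)⁻¹ - 1) =
          (F.card : ℝ)⁻¹ - |a x - b x| := by
        field_simp
      rw [h3] at h2
      simp only [Real.negMulLog]
      linarith
  have hD : ∑ x ∈ F, |a x - b x| ≤ 2 * δ := by
    rw [← Finset.sum_filter_add_sum_filter_not F (fun x => b x ≤ a x)]
    have h1 := (abs_le.1 (h (F.filter fun x => b x ≤ a x) (Finset.filter_subset _ _))).2
    have h2 := (abs_le.1 (h (F.filter fun x => ¬ b x ≤ a x) (Finset.filter_subset _ _))).1
    rw [← Finset.sum_sub_distrib] at h1 h2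
    have e1 : ∑ x ∈ F.filter (fun x => b x ≤ a x), |a x - b x| =
        ∑ x ∈ F.filter (fun x => b x ≤ a x), (a x - b x) :=
      Finset.sum_congr rfl fun x hx =>
        abs_of_nonneg (sub_nonneg.2 (Finset.mem_filter.1 hx).2)
    have e2 : ∑ x ∈ F.filter (fun x => ¬ b x ≤ a x), |a x - b x| =
        -∑ x ∈ F.filter (fun x => ¬ b x ≤ a x), (a x - b x) := by
      rw [← Finset.sum_neg_distrib]
      exact Finset.sum_congr rfl fun x hx =>
        abs_of_nonpos (by have := (Finset.mem_filter.1 hx).2; linarith)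
    linarith
  have hlog : 0 ≤ Real.log F.card := Real.log_natCast_nonneg _
  rw [← Finset.sum_sub_distrib]
  calc |∑ x ∈ F, (Real.negMulLog (a x) - Real.negMulLog (b x))|
      ≤ ∑ x ∈ F, |Real.negMulLog (a x) - Real.negMulLog (b x)| := Finset.abs_sum_le_sum_abs _ _
    _ ≤ ∑ x ∈ F, (|a x - b x| * Real.log F.card + (F.card : ℝ)⁻¹) :=
        Finset.sum_le_sum fun x _ => by
          have := abs_negMulLog_sub_le (ha x) (hb x) (ha1 x) (hb1 x)
          have := htan x
          linarith
    _ = (∑ x ∈ F, |a x - b x|) * Real.log F.card + 1 := by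
        rw [Finset.sum_add_distrib, ← Finset.sum_mul, Finset.sum_const, nsmul_eq_mul,
          mul_inv_cancel₀ hc.ne']
    _ ≤ 2 * δ * Real.log F.card + 1 := by gcongr

end Continuity

/-! ### Traces and blocks -/

section Blocks

variable {O X : Type}

@[simp] lemma length_trace (f : List O → X) (h : List O) : (trace f h).length = h.length := by
  induction h with
  | nil => rfl
  | cons o h ih => simp [trace, ih]

lemma drop_trace (f : List O → X) (n : ℕ) (h : List O) :
    (trace f h).drop n = trace f (h.drop n) := by
  induction n generalizing h with
  | zero => rfl
  | succ n ih => cases h with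
    | nil => rfl
    | cons o h => simpa [trace] using ih h

lemma map_trace {Y : Type} (f : List O → X) (φ : X → Y) (h : List O) :
    (trace f h).map φ = trace (fun g => φ (f g)) h := by
  induction h with
  | nil => rfl
  | cons o h ih => simp [trace, ih]

variable [Fintype O] {p : List O → ℝ}

lemma IsHistoryLaw.pos_of_cons (hp : IsHistoryLaw p) {o : O} {h : List O} (h0 : 0 < p (o :: h)) :
    0 < p h := by
  rw [← hp.sum_cons h]
  exact h0.trans_le (Finset.single_le_sum (f := fun o => p (o :: h)) (fun _ _ => hp.nonneg _)
    (Finset.mem_univ o))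

lemma mem_of_mem_trace (hp : IsHistoryLaw p) {f : List O → X} {𝒜 : Finset X}
    (h𝒜 : ∀ h, 0 < p h → f h ∈ 𝒜) {h : List O} (h0 : 0 < p h) : ∀ x ∈ trace f h, x ∈ 𝒜 := by
  induction h with
  | nil => simp [trace]
  | cons o h ih =>
    intro x hx
    rcases List.mem_cons.1 hx with rfl | hx
    · exact h𝒜 _ h0
    · exact ih (hp.pos_of_cons h0) x hx

open Classical in
/-- The words of length `k` over the alphabet `𝒜`. -/
noncomputable def words (𝒜 : Finset X) (k : ℕ) : Finset (List X) :=
  (Fintype.piFinset fun _ : Fin k => 𝒜).image List.ofFn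

lemma mem_words {𝒜 : Finset X} {k : ℕ} {l : List X} (hl : l.length = k) (h : ∀ x ∈ l, x ∈ 𝒜) :
    l ∈ words 𝒜 k := by
  classical
  subst hl
  exact Finset.mem_image.2 ⟨l.get, Fintype.mem_piFinset.2 fun i => h _ (l.get_mem i), by simp⟩

lemma card_words_le (𝒜 : Finset X) (k : ℕ) : (words 𝒜 k).card ≤ 𝒜.card ^ k := by
  classical
  exact Finset.card_image_le.trans (by simp [Fintype.card_piFinset])

lemma take_trace_mem_words (hp : IsHistoryLaw p) {f : List O → X} {𝒜 : Finset X}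
    (h𝒜 : ∀ h, 0 < p h → f h ∈ 𝒜) {t k : ℕ} {h : List O} (hT : h.length = t + k)
    (h0 : 0 < p h) : (trace f h).take k ∈ words 𝒜 k :=
  mem_words (by simp [hT]) fun x hx => mem_of_mem_trace hp h𝒜 h0 x (List.mem_of_mem_take hx)

/-- The entropy of the `k` values of `f` that follow the time `t`. -/
noncomputable def shiftedBlockEntropy (p : List O → ℝ) (f : List O → X) (t k : ℕ) : ℝ :=
  entropy p (t + k) (fun h => (trace f h).take k)

lemma shiftedBlockEntropy_zero (hp : IsHistoryLaw p) (f : List O → X) (k : ℕ) :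
    shiftedBlockEntropy p f 0 k = entropy p k (trace f) := by
  rw [shiftedBlockEntropy, Nat.zero_add]
  refine entropy_congr hp fun h h' hh hh' => ?_
  rw [List.take_of_length_le (by simp [hh]), List.take_of_length_le (by simp [hh'])]

lemma shiftedBlockEntropy_add_le (hp : IsHistoryLaw p) (f : List O → X) (t m n : ℕ) :
    shiftedBlockEntropy p f t (m + n) ≤
      shiftedBlockEntropy p f t m + shiftedBlockEntropy p f (t + m) n := by
  have h1 := entropy_prod_le hp (t + m + n) (fun h => (trace f (h.drop n)).take m)
    (fun h => (trace f h).take n)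
  rw [entropy_drop hp (t + m) n (fun h => (trace f h).take m)] at h1
  refine le_trans ?_ h1
  rw [shiftedBlockEntropy, ← add_assoc]
  refine entropy_le_of_determined hp fun h h' _ _ e => ?_
  obtain ⟨e1, e2⟩ := Prod.mk.inj e
  rw [Nat.add_comm m n, List.take_add, List.take_add, drop_trace, drop_trace, e1, e2]

lemma shiftedBlockEntropy_le (hp : IsHistoryLaw p) (f : List O → X) (t k : ℕ) :
    shiftedBlockEntropy p f t k ≤ entropy p (t + k) (trace f) :=
  entropy_le_of_determined hp fun h h' _ _ e => by rw [e]

lemma entropy_trace_le (hp : IsHistoryLaw p) {f : List O → X} {𝒜 : Finset X}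
    (h𝒜 : ∀ h, 0 < p h → f h ∈ 𝒜) (t : ℕ) :
    entropy p t (trace f) ≤ t * Real.logb 2 𝒜.card := by
  have hne : 𝒜.Nonempty := ⟨_, h𝒜 [] (by rw [hp.nil]; norm_num)⟩
  have hw : ∀ h : List O, h.length = t → 0 < p h → trace f h ∈ words 𝒜 t := fun h hT h0 =>
    mem_words (by simp [hT]) (mem_of_mem_trace hp h𝒜 h0)
  rcases (words 𝒜 t).eq_empty_or_nonempty with hw0 | hw0
  · rw [entropy_eq_sum hp hw, hw0, Finset.sum_empty]
    exact mul_nonneg (by positivity)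
      (Real.logb_nonneg (by norm_num) (by exact_mod_cast hne.card_pos))
  · rw [← Real.logb_pow]
    refine (entropy_le_logb_card hp hw hw0).trans (Real.logb_le_logb_of_le (by norm_num) ?_ ?_)
    · exact_mod_cast hw0.card_pos
    · exact_mod_cast card_words_le 𝒜 t

/-- Fekete's lemma with errors: if `u (t + k)` differs from a subadditive `G k` by at most
`c t + k * d t`, with `d t → 0`, then `u n / n` has the limit of `G n / n`. -/
lemma tendsto_div_of_abs_sub_subadditive_le {u G c d : ℕ → ℝ} (hG : Subadditive G)
    (hG0 : ∀ n, 0 ≤ G n) (hd : Tendsto d atTop (𝓝 0))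
    (h : ∀ t k : ℕ, |u (t + k) - G k| ≤ c t + k * d t) :
    Tendsto (fun n : ℕ => u n / n) atTop (𝓝 hG.lim) := by
  have hlim : Tendsto (fun n : ℕ => G n / n) atTop (𝓝 hG.lim) :=
    hG.tendsto_lim ⟨0, by
      rintro _ ⟨n, rfl⟩
      exact div_nonneg (hG0 n) (Nat.cast_nonneg n)⟩
  rw [Metric.tendsto_atTop]
  intro ε hε
  obtain ⟨t, ht⟩ := (hd.eventually (gt_mem_nhds (show (0 : ℝ) < ε / 2 by linarith))).exists
  have hR : Tendsto (fun k : ℕ => (|c t| + t * |hG.lim|) / k + |G k / k - hG.lim|) atTop (𝓝 0) := by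
    have h1 := tendsto_const_div_atTop_nhds_zero_nat (|c t| + t * |hG.lim|)
    have h2 := (hlim.sub_const hG.lim).abs
    simpa using h1.add h2
  obtain ⟨k₀, hk₀⟩ := eventually_atTop.1
    ((hR.eventually (gt_mem_nhds (show (0 : ℝ) < ε / 2 by linarith))).and
      (eventually_gt_atTop 0))
  refine ⟨t + k₀, fun n hn => ?_⟩
  obtain ⟨k, rfl⟩ := Nat.exists_eq_add_of_le (le_of_add_le_left hn)
  obtain ⟨hk1, hk2⟩ := hk₀ k (by omega)
  have hk : (0 : ℝ) < k := by exact_mod_cast hk2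
  have hn0 : (0 : ℝ) < ((t + k : ℕ) : ℝ) := by exact_mod_cast (by omega : 0 < t + k)
  rw [Real.dist_eq]
  have e1 : u (t + k) / ((t + k : ℕ) : ℝ) - hG.lim =
      (u (t + k) - ((t + k : ℕ) : ℝ) * hG.lim) / ((t + k : ℕ) : ℝ) := by
    field_simp
  rw [e1, abs_div, abs_of_pos hn0]
  have e2 : |u (t + k) - ((t + k : ℕ) : ℝ) * hG.lim| ≤
      |c t| + t * |hG.lim| + k * |G k / k - hG.lim| + k * d t := by
    have e3 : u (t + k) - ((t + k : ℕ) : ℝ) * hG.lim =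
        (u (t + k) - G k) + k * (G k / k - hG.lim) - t * hG.lim := by
      push_cast
      field_simp
      ring
    rw [e3]
    calc _ ≤ |u (t + k) - G k| + |k * (G k / k - hG.lim)| + |t * hG.lim| :=
          (abs_sub _ _).trans (by gcongr; exact abs_add_le _ _)
      _ ≤ _ := by
          rw [abs_mul, abs_mul, Nat.abs_cast, Nat.abs_cast]
          have := h t k
          have := le_abs_self (c t)
          linarith
  calc _ ≤ (|c t| + t * |hG.lim| + k * |G k / k - hG.lim| + k * (ε / 2)) / ((t + k : ℕ) : ℝ) := by
        gcongr
        refine e2.trans ?_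
        gcongr
    _ ≤ (|c t| + t * |hG.lim| + k * |G k / k - hG.lim| + k * (ε / 2)) / k := by
        gcongr
        · exact_mod_cast Nat.le_add_left k t
    _ = (|c t| + t * |hG.lim|) / k + |G k / k - hG.lim| + ε / 2 := by
        field_simp
    _ < ε := by linarith

/-- A process with a finite alphabet whose future converges in total variation has an entropy
rate: the block entropies of the limit process are subadditive, and they differ from those of the
process itself by `O(t) + o(1) * k`. -/
lemma exists_tendsto_entropy_div (hp : IsHistoryLaw p) {f : List O → X} {𝒜 : Finset X}
    (h𝒜 : ∀ h, 0 < p h → f h ∈ 𝒜) {δ : ℕ → ℝ} (hδ : Tendsto δ atTop (𝓝 0))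
    {ν : ℕ → Set (List X) → ℝ}
    (hν : ∀ t k B, |eventProb p (t + k) (fun h => (trace f h).take k ∈ B) - ν k B| ≤ δ t) :
    ∃ r, Tendsto (fun T : ℕ => entropy p T (trace f) / T) atTop (𝓝 r) := by
  classical
  have hlim : ∀ k B, Tendsto (fun t => eventProb p (t + k) (fun h => (trace f h).take k ∈ B))
      atTop (𝓝 (ν k B)) := fun k B =>
    tendsto_iff_dist_tendsto_zero.2
      (squeeze_zero (fun _ => dist_nonneg) (fun t => hν t k B) hδ)
  have hlim1 : ∀ k l, Tendsto (fun t => eventProb p (t + k) (fun h => (trace f h).take k = l))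
      atTop (𝓝 (ν k {l})) := fun k l => hlim k {l}
  have hν0 : ∀ k l, 0 ≤ ν k {l} := fun k l =>
    ge_of_tendsto' (hlim1 k l) fun t => eventProb_nonneg hp _ _
  have hν1 : ∀ k l, ν k {l} ≤ 1 := fun k l =>
    le_of_tendsto' (hlim1 k l) fun t => eventProb_le_one hp _ _
  have hνsum : ∀ k (B : Finset (List X)), ν k B = ∑ l ∈ B, ν k {l} := fun k B =>
    tendsto_nhds_unique (hlim k B) <| by
      simp only [Finset.mem_coe, eventProb_mem_eq_sum]
      exact tendsto_finsetSum _ fun l _ => hlim1 k l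
  set G : ℕ → ℝ := fun k => ∑ l ∈ words 𝒜 k, Real.negMulLog (ν k {l}) / Real.log 2 with hGdef
  have ha : ∀ t k, shiftedBlockEntropy p f t k = ∑ l ∈ words 𝒜 k,
      Real.negMulLog (eventProb p (t + k) (fun h => (trace f h).take k = l)) / Real.log 2 :=
    fun t k => entropy_eq_sum hp fun h hT h0 => take_trace_mem_words hp h𝒜 hT h0
  have hlimG : ∀ k, Tendsto (fun t => shiftedBlockEntropy p f t k) atTop (𝓝 (G k)) := by
    intro k
    simp only [ha]
    exact tendsto_finsetSum _ fun l _ =>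
      ((Real.continuous_negMulLog.tendsto _).comp (hlim1 k l)).div_const _
  have hG : Subadditive G := fun m n =>
    le_of_tendsto_of_tendsto' (hlimG (m + n))
      ((hlimG m).add ((hlimG n).comp (tendsto_add_atTop_nat m)))
      fun t => shiftedBlockEntropy_add_le hp f t m n
  have hG0 : ∀ n, 0 ≤ G n := fun n =>
    ge_of_tendsto' (hlimG n) fun t => entropy_nonneg hp _ _
  have hδ0 : ∀ t, 0 ≤ δ t := fun t => (abs_nonneg _).trans (hν t 0 ∅)
  have hl2 : 0 < Real.log 2 := Real.log_pos (by norm_num)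
  have hL : 0 ≤ Real.logb 2 𝒜.card :=
    div_nonneg (Real.log_natCast_nonneg _) hl2.le
  have hclose : ∀ t k, |shiftedBlockEntropy p f t k - G k| ≤
      k * (2 * δ t * Real.logb 2 𝒜.card) + 1 / Real.log 2 := by
    intro t k
    have h1 := abs_sum_negMulLog_sub_le (F := words 𝒜 k)
      (a := fun l => eventProb p (t + k) (fun h => (trace f h).take k = l))
      (b := fun l => ν k {l}) (δ := δ t)
      (fun l => eventProb_nonneg hp _ _) (hν0 k) (fun l => eventProb_le_one hp _ _) (hν1 k)
      (fun B _ => by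
        rw [← hνsum, ← eventProb_mem_eq_sum]
        exact hν t k B)
    have h2 : Real.log (words 𝒜 k).card ≤ k * Real.log 𝒜.card := by
      rw [← Real.log_pow]
      rcases (words 𝒜 k).card.eq_zero_or_pos with h0 | h0
      · rw [h0, Nat.cast_zero, Real.log_zero]
        exact_mod_cast Real.log_natCast_nonneg (𝒜.card ^ k)
      · exact Real.log_le_log (by exact_mod_cast h0) (by exact_mod_cast card_words_le 𝒜 k)
    rw [ha, hGdef]
    simp only [← Finset.sum_div, ← sub_div]
    rw [abs_div, abs_of_pos hl2, div_le_iff₀ hl2, add_mul, div_mul_cancel₀ _ hl2.ne', Real.logb]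
    have h3 : k * (2 * δ t * (Real.log 𝒜.card / Real.log 2)) * Real.log 2 =
        2 * δ t * (k * Real.log 𝒜.card) := by
      field_simp
    rw [h3]
    refine h1.trans ?_
    have := hδ0 t
    gcongr
  refine ⟨hG.lim, tendsto_div_of_abs_sub_subadditive_le hG hG0
    (c := fun t => t * Real.logb 2 𝒜.card + 1 / Real.log 2)
    (d := fun t => 2 * δ t * Real.logb 2 𝒜.card)
    (by simpa using (hδ.const_mul 2).mul_const (Real.logb 2 𝒜.card)) fun t k => ?_⟩
  have h1 := shiftedBlockEntropy_le hp f t k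
  have h2 := shiftedBlockEntropy_add_le hp f 0 t k
  rw [shiftedBlockEntropy_zero hp, shiftedBlockEntropy_zero hp, Nat.zero_add] at h2
  have h3 := entropy_trace_le hp h𝒜 t
  obtain ⟨h4, h5⟩ := abs_le.1 (hclose t k)
  have h6 : 0 ≤ t * Real.logb 2 𝒜.card := by positivity
  rw [abs_le]
  constructor <;> linarith

end Blocks

/-! ### The intent distortion -/

section Distortion

variable {S A : Type} [Fintype A]

lemma tv_nonneg (p q : A → ℝ) : 0 ≤ tv p q :=
  div_nonneg (Finset.sum_nonneg fun _ _ => abs_nonneg _) (by norm_num)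

lemma tv_triangle (p q r : A → ℝ) : tv p r ≤ tv p q + tv q r := by
  simp only [tv, ← add_div, ← Finset.sum_add_distrib]
  gcongr
  exact abs_sub_le _ _ _

variable [Fintype S] [MetricSpace S]

lemma wasserstein_nonneg (p q : S → ℝ) : 0 ≤ wasserstein p q := by
  refine Real.sInf_nonneg ?_
  rintro c ⟨γ, h0, -, -, rfl⟩
  exact Finset.sum_nonneg fun x _ => Finset.sum_nonneg fun y _ => mul_nonneg (h0 x y) dist_nonneg

lemma wasserstein_le {p q : S → ℝ} {γ : S → S → ℝ} (h0 : ∀ x y, 0 ≤ γ x y)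
    (h1 : ∀ x, ∑ y, γ x y = p x) (h2 : ∀ y, ∑ x, γ x y = q y) :
    wasserstein p q ≤ ∑ x, ∑ y, γ x y * dist x y := by
  refine csInf_le ⟨0, ?_⟩ ⟨γ, h0, h1, h2, rfl⟩
  rintro c ⟨γ, h0, -, -, rfl⟩
  exact Finset.sum_nonneg fun x _ => Finset.sum_nonneg fun y _ => mul_nonneg (h0 x y) dist_nonneg

/-- To bound the Wasserstein distance of probability vectors from below it is enough to bound the
cost of all couplings. The product coupling shows that there are couplings. -/
lemma le_wasserstein {p q : S → ℝ} (hp : p ∈ stdSimplex ℝ S) (hq : q ∈ stdSimplex ℝ S) {c : ℝ}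
    (h : ∀ γ : S → S → ℝ, (∀ x y, 0 ≤ γ x y) → (∀ x, ∑ y, γ x y = p x) →
      (∀ y, ∑ x, γ x y = q y) → c ≤ ∑ x, ∑ y, γ x y * dist x y) :
    c ≤ wasserstein p q := by
  refine le_csInf ⟨_, fun x y => p x * q y, fun x y => mul_nonneg (hp.1 x) (hq.1 y), fun x => ?_,
    fun y => ?_, rfl⟩ ?_
  · rw [← Finset.mul_sum, hq.2, mul_one]
  · rw [← Finset.sum_mul, hp.2, one_mul]
  · rintro _ ⟨γ, h0, h1, h2, rfl⟩
    exact h γ h0 h1 h2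

lemma wasserstein_comm (p q : S → ℝ) : wasserstein p q = wasserstein q p := by
  have key : ∀ p q : S → ℝ, ∀ c, (∃ γ : S → S → ℝ, (∀ x y, 0 ≤ γ x y) ∧
      (∀ x, ∑ y, γ x y = p x) ∧ (∀ y, ∑ x, γ x y = q y) ∧ c = ∑ x, ∑ y, γ x y * dist x y) →
      ∃ γ : S → S → ℝ, (∀ x y, 0 ≤ γ x y) ∧
      (∀ x, ∑ y, γ x y = q x) ∧ (∀ y, ∑ x, γ x y = p y) ∧
        c = ∑ x, ∑ y, γ x y * dist x y := by
    rintro p q c ⟨γ, h0, h1, h2, rfl⟩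
    refine ⟨fun x y => γ y x, fun x y => h0 y x, h2, h1, ?_⟩
    rw [Finset.sum_comm]
    simp only [dist_comm]
  rw [wasserstein, wasserstein]
  congr 1
  ext c
  exact ⟨key p q c, key q p c⟩

/-- The triangle inequality, by gluing two couplings along the middle marginal. -/
lemma wasserstein_triangle {p q r : S → ℝ} (hp : p ∈ stdSimplex ℝ S) (hq : q ∈ stdSimplex ℝ S)
    (hr : r ∈ stdSimplex ℝ S) : wasserstein p r ≤ wasserstein p q + wasserstein q r := by
  rw [← sub_le_iff_le_add]
  refine le_wasserstein hp hq fun γ g0 g1 g2 => ?_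
  rw [sub_le_comm]
  refine le_wasserstein hq hr fun κ k0 k1 k2 => ?_
  rw [sub_le_iff_le_add]
  have hγ : ∀ x y, q y = 0 → γ x y = 0 := fun x y hy =>
    (Finset.sum_eq_zero_iff_of_nonneg (fun x _ => g0 x y)).1 ((g2 y).trans hy) x
      (Finset.mem_univ x)
  have hκ : ∀ y z, q y = 0 → κ y z = 0 := fun y z hy =>
    (Finset.sum_eq_zero_iff_of_nonneg (fun z _ => k0 y z)).1 ((k1 y).trans hy) z
      (Finset.mem_univ z)
  have e1 : ∀ x y, ∑ z, γ x y * κ y z / q y = γ x y := by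
    intro x y
    rw [← Finset.sum_div, ← Finset.mul_sum, k1]
    rcases eq_or_ne (q y) 0 with hy | hy
    · simp [hy, hγ x y hy]
    · rw [mul_div_cancel_right₀ _ hy]
  have e2 : ∀ y z, ∑ x, γ x y * κ y z / q y = κ y z := by
    intro y z
    rw [← Finset.sum_div, ← Finset.sum_mul, g2]
    rcases eq_or_ne (q y) 0 with hy | hy
    · simp [hy, hκ y z hy]
    · rw [mul_div_cancel_left₀ _ hy]
  have h0 : ∀ x y z, 0 ≤ γ x y * κ y z / q y := fun x y z =>
    div_nonneg (mul_nonneg (g0 x y) (k0 y z)) (hq.1 y)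
  refine (wasserstein_le (γ := fun x z => ∑ y, γ x y * κ y z / q y)
    (fun x z => Finset.sum_nonneg fun y _ => h0 x y z) (fun x => ?_) (fun z => ?_)).trans ?_
  · rw [Finset.sum_comm, ← g1 x]
    exact Finset.sum_congr rfl fun y _ => e1 x y
  · rw [Finset.sum_comm, ← k2 z]
    exact Finset.sum_congr rfl fun y _ => e2 y z
  · calc ∑ x, ∑ z, (∑ y, γ x y * κ y z / q y) * dist x z
        ≤ ∑ x, ∑ z, ∑ y, (γ x y * κ y z / q y * dist y z + γ x y * κ y z / q y * dist x y) := by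
          refine Finset.sum_le_sum fun x _ => Finset.sum_le_sum fun z _ => ?_
          rw [Finset.sum_mul]
          refine Finset.sum_le_sum fun y _ => ?_
          rw [← mul_add, add_comm]
          exact mul_le_mul_of_nonneg_left (dist_triangle x y z) (h0 x y z)
      _ = ∑ y, ∑ z, κ y z * dist y z + ∑ x, ∑ y, γ x y * dist x y := by
          simp only [Finset.sum_add_distrib]
          congr 1
          · calc _ = ∑ x, ∑ y, ∑ z, γ x y * κ y z / q y * dist y z :=
                  Finset.sum_congr rfl fun x _ => Finset.sum_comm
              _ = ∑ y, ∑ x, ∑ z, γ x y * κ y z / q y * dist y z := Finset.sum_comm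
              _ = ∑ y, ∑ z, ∑ x, γ x y * κ y z / q y * dist y z :=
                  Finset.sum_congr rfl fun y _ => Finset.sum_comm
              _ = _ := by simp only [← Finset.sum_mul, e2]
          · refine Finset.sum_congr rfl fun x _ => ?_
            rw [Finset.sum_comm]
            simp only [← Finset.sum_mul, e1]
      _ = _ := by ring

/-- Distinct points have a positive distance, so a cheap coupling is almost diagonal. -/
lemma eq_of_wasserstein_eq_zero {p q : S → ℝ} (hp : p ∈ stdSimplex ℝ S)
    (hq : q ∈ stdSimplex ℝ S) (h : wasserstein p q = 0) : p = q := by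
  classical
  obtain ⟨⟨m, hm0⟩, hm⟩ := Finite.exists_ge
    (fun z : {z : S × S // z.1 ≠ z.2} => (⟨dist z.1.1 z.1.2, dist_pos.2 z.2⟩ : {r : ℝ // 0 < r}))
  have hm : ∀ x y : S, x ≠ y → m ≤ dist x y := fun x y hxy => hm ⟨(x, y), hxy⟩
  have key : ∀ p q : S → ℝ, p ∈ stdSimplex ℝ S → q ∈ stdSimplex ℝ S → ∀ x,
      m * (p x - q x) ≤ wasserstein p q := by
    intro p q hp hq x
    refine le_wasserstein hp hq fun γ g0 g1 g2 => ?_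
    calc m * (p x - q x) ≤ m * (∑ y, γ x y - γ x x) := by
          gcongr
          · exact (g1 x).ge
          · rw [← g2 x]
            exact Finset.single_le_sum (f := fun y => γ y x) (fun y _ => g0 y x)
              (Finset.mem_univ x)
      _ = ∑ y, m * (γ x y - if y = x then γ x x else 0) := by
          rw [← Finset.mul_sum, Finset.sum_sub_distrib, Finset.sum_ite_eq' Finset.univ x]
          simp
      _ ≤ ∑ y, γ x y * dist x y := by
          refine Finset.sum_le_sum fun y _ => ?_
          by_cases hxy : y = x
          · subst hxy
            simp
          · rw [if_neg hxy, sub_zero, mul_comm]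
            exact mul_le_mul_of_nonneg_left (hm x y (Ne.symm hxy)) (g0 x y)
      _ ≤ ∑ x, ∑ y, γ x y * dist x y :=
          Finset.single_le_sum (f := fun x => ∑ y, γ x y * dist x y)
            (fun x _ => Finset.sum_nonneg fun y _ => mul_nonneg (g0 x y) dist_nonneg)
            (Finset.mem_univ x)
  funext x
  have h1 := key p q hp hq x
  have h2 := key q p hq hp x
  rw [wasserstein_comm q p] at h2
  rw [h] at h1 h2
  have h3 := nonpos_of_mul_nonpos_right h1 hm0
  have h4 := nonpos_of_mul_nonpos_right h2 hm0
  linarith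

lemma dIntent_nonneg (i j : Intent S A) : 0 ≤ dIntent i j :=
  add_nonneg (add_nonneg (wasserstein_nonneg _ _) (tv_nonneg _ _)) (abs_nonneg _)

lemma dIntent_comm (i j : Intent S A) : dIntent i j = dIntent j i := by
  simp only [dIntent, tv]
  rw [wasserstein_comm, abs_sub_comm i.value]
  simp only [abs_sub_comm]

lemma dIntent_triangle {i j k : Intent S A} (hi : i.belief ∈ stdSimplex ℝ S)
    (hj : j.belief ∈ stdSimplex ℝ S) (hk : k.belief ∈ stdSimplex ℝ S) :
    dIntent i k ≤ dIntent i j + dIntent j k := by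
  have h1 := wasserstein_triangle hi hj hk
  have h2 := tv_triangle i.policy j.policy k.policy
  have h3 := abs_sub_le i.value j.value k.value
  simp only [dIntent]
  linarith

end Distortion

/-! ### The source and its receiver -/

lemma sum_sum_sum_rotate {α β γ : Type} [Fintype α] [Fintype β] [Fintype γ]
    (F : α → β → γ → ℝ) : ∑ x, ∑ y, ∑ z, F x y z = ∑ y, ∑ z, ∑ x, F x y z := by
  rw [Finset.sum_comm]
  exact Finset.sum_congr rfl fun y _ => Finset.sum_comm

namespace Source

variable {S A O : Type} [Fintype S] [Fintype A] [Fintype O] (src : Source S A O)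

lemma weight_nonneg (h : List O) (s : S) (n : Fin src.nodes) : 0 ≤ src.weight h s n := by
  classical
  induction h generalizing s n with
  | nil =>
    rw [weight]
    split_ifs
    · exact stdSimplex.zero_le _ _
    · exact le_rfl
  | cons o h ih =>
    rw [weight]
    refine Finset.sum_nonneg fun s₁ _ => Finset.sum_nonneg fun n₁ _ => mul_nonneg (ih _ _)
      (Finset.sum_nonneg fun a _ => ?_)
    exact mul_nonneg (mul_nonneg (mul_nonneg (stdSimplex.zero_le _ _) (stdSimplex.zero_le _ _))
      (stdSimplex.zero_le _ _)) (stdSimplex.zero_le _ _)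

lemma sum_transition (s : S) (n : Fin src.nodes) :
    ∑ o, ∑ s', ∑ n', ∑ a, src.policy.β n a * src.M.P s a s' * src.M.Z s' a o *
      src.policy.α n o n' = 1 := by
  calc _ = ∑ o, ∑ s', ∑ a, src.policy.β n a * src.M.P s a s' * src.M.Z s' a o := by
        refine Finset.sum_congr rfl fun o _ => Finset.sum_congr rfl fun s' _ => ?_
        rw [Finset.sum_comm]
        simp only [← Finset.mul_sum, stdSimplex.sum_eq_one, mul_one]
    _ = ∑ s', ∑ a, ∑ o, src.policy.β n a * src.M.P s a s' * src.M.Z s' a o :=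
        sum_sum_sum_rotate _
    _ = ∑ a, ∑ s', src.policy.β n a * src.M.P s a s' := by
        rw [Finset.sum_comm]
        simp only [← Finset.mul_sum, stdSimplex.sum_eq_one, mul_one]
    _ = 1 := by
        simp only [← Finset.mul_sum, stdSimplex.sum_eq_one, mul_one]

lemma isHistoryLaw_prob : IsHistoryLaw src.prob where
  nonneg h := Finset.sum_nonneg fun s _ => Finset.sum_nonneg fun n _ => src.weight_nonneg h s n
  nil := by
    simp only [prob, weight, Finset.sum_ite_eq', Finset.mem_univ, if_true, stdSimplex.sum_eq_one]
  sum_cons h := by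
    simp only [prob, weight]
    calc _ = ∑ o, ∑ s', ∑ s, ∑ n, ∑ n', src.weight h s n * ∑ a, src.policy.β n a *
          src.M.P s a s' * src.M.Z s' a o * src.policy.α n o n' :=
          Finset.sum_congr rfl fun o _ => Finset.sum_congr rfl fun s' _ => sum_sum_sum_rotate _
      _ = ∑ o, ∑ s, ∑ n, ∑ s', ∑ n', src.weight h s n * ∑ a, src.policy.β n a *
          src.M.P s a s' * src.M.Z s' a o * src.policy.α n o n' :=
          Finset.sum_congr rfl fun o _ => sum_sum_sum_rotate _
      _ = ∑ s, ∑ n, ∑ o, ∑ s', ∑ n', src.weight h s n * ∑ a, src.policy.β n a *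
          src.M.P s a s' * src.M.Z s' a o * src.policy.α n o n' := sum_sum_sum_rotate _
      _ = _ := by simp only [← Finset.mul_sum, sum_transition, mul_one]

lemma belief_mem_stdSimplex {h : List O} (hr : src.Reachable h) :
    src.belief h ∈ stdSimplex ℝ S := by
  refine ⟨fun s => div_nonneg (Finset.sum_nonneg fun n _ => src.weight_nonneg h s n)
    (src.isHistoryLaw_prob.nonneg h), ?_⟩
  simp only [belief]
  rw [← Finset.sum_div]
  exact div_self (ne_of_gt hr)

/-- An agent with fewer nodes distinguishes fewer histories. -/
lemma cls_eq_of_le {mA mB : ℕ} (hm : mB ≤ mA) {h h' : List O} (e : src.cls mA h = src.cls mA h') :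
    src.cls mB h = src.cls mB h' := by
  obtain ⟨h1, h2⟩ := Quotient.exact e
  exact Quotient.sound ⟨h1, fun k hk => h2 k (hk.trans hm)⟩

/-- Future observation laws depend on the history through the belief only. -/
lemma cls_eq_of_belief_eq {mA mB : ℕ} {h h' : List O} (e : src.cls mB h = src.cls mB h')
    (hb : src.belief h = src.belief h') : src.cls mA h = src.cls mA h' := by
  obtain ⟨h1, -⟩ := Quotient.exact e
  refine Quotient.sound ⟨h1, fun k hk π w _ => ?_⟩
  rw [futureLaw, futureLaw, hb]

lemma alphabet_finite_of_le {mA mB : ℕ} (hm : mB ≤ mA) (hfin : (src.alphabet mA).Finite) :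
    (src.alphabet mB).Finite := by
  let F : src.QClass mA → src.QClass mB :=
    Quotient.lift (src.cls mB) fun h h' e => src.cls_eq_of_le hm (Quotient.sound e)
  refine (hfin.image F).subset ?_
  rintro _ ⟨h, hr, rfl⟩
  exact ⟨src.cls mA h, ⟨h, hr, rfl⟩, rfl⟩

/-- The separation constant is positive. Intent measurability leaves finitely many intents of the
sender, and the belief together with the receiver's class determines the sender's class, so that
the infimum runs over a finite set of positive distances. -/
lemma cM_pos [MetricSpace S] {mA mB : ℕ} (hfin : (src.alphabet mA).Finite)
    (hintent : src.IntentMeasurable mA) : 0 < src.cM mA mB := by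
  classical
  set I : Set (Intent S A) := {i | ∃ h, src.Reachable h ∧ src.intent h = i} with hI
  have hIfin : I.Finite := by
    refine (hfin.image fun q => if hq : ∃ h, src.Reachable h ∧ src.cls mA h = q then
      src.intent hq.choose else src.intent []).subset ?_
    rintro _ ⟨h, hr, rfl⟩
    have hq : ∃ h', src.Reachable h' ∧ src.cls mA h' = src.cls mA h := ⟨h, hr, rfl⟩
    refine ⟨src.cls mA h, hq, ?_⟩
    simp only [dif_pos hq]
    exact hintent _ _ hq.choose_spec.1 hr hq.choose_spec.2
  have := hIfin.to_subtype
  obtain ⟨⟨m, hm0⟩, hm⟩ := Finite.exists_ge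
    (fun z : {z : I × I // 0 < dIntent z.1.1 z.2.1} =>
      (⟨dIntent z.1.1.1 z.1.2.1, z.2⟩ : {r : ℝ // 0 < r}))
  refine (ENNReal.ofReal_pos.2 hm0).trans_le ?_
  simp only [cM, le_iInf_iff]
  intro h h' hr hr' hA hB
  refine ENNReal.ofReal_le_ofReal ?_
  have hpos : 0 < dIntent (src.intent h) (src.intent h') := by
    refine (dIntent_nonneg _ _).lt_of_ne fun e => hA (src.cls_eq_of_belief_eq hB ?_)
    refine eq_of_wasserstein_eq_zero (src.belief_mem_stdSimplex hr)
      (src.belief_mem_stdSimplex hr') (le_antisymm ?_ (wasserstein_nonneg _ _))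
    have h1 := tv_nonneg (src.intent h).policy (src.intent h').policy
    have h2 := abs_nonneg ((src.intent h).value - (src.intent h').value)
    simp only [dIntent] at e
    change wasserstein (src.intent h).belief (src.intent h').belief ≤ 0
    linarith
  exact hm ⟨(⟨_, h, hr, rfl⟩, ⟨_, h', hr', rfl⟩), hpos⟩

section Receiver

variable {J : TwoAgentKernels S A O} {K mB : ℕ} (p : Protocol K mB (src.QClass mB) A O)

lemma jointWeight_nonneg (h : List O) (s : S) (n : Fin src.nodes) (l : Fin mB) :
    0 ≤ src.jointWeight J p h s n l := by
  classical
  induction h generalizing s n l with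
  | nil =>
    rw [jointWeight]
    split_ifs
    · exact stdSimplex.zero_le _ _
    · exact le_rfl
  | cons o h ih =>
    rw [jointWeight]
    refine Finset.sum_nonneg fun s₁ _ => Finset.sum_nonneg fun n₁ _ => Finset.sum_nonneg fun l₁ _ =>
      mul_nonneg (ih _ _ _) (Finset.sum_nonneg fun a _ => Finset.sum_nonneg fun b _ => ?_)
    exact mul_nonneg (mul_nonneg (mul_nonneg (mul_nonneg (mul_nonneg (stdSimplex.zero_le _ _)
      (stdSimplex.zero_le _ _)) (stdSimplex.zero_le _ _)) (stdSimplex.zero_le _ _))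
      (stdSimplex.zero_le _ _)) (stdSimplex.zero_le _ _)

/-- Under one-way observability the receiver's controller can be marginalized out. -/
lemma sum_jointWeight (hJ : J.OneWay src.M) (h : List O) (s : S) (n : Fin src.nodes) :
    ∑ l, src.jointWeight J p h s n l = src.weight h s n := by
  classical
  induction h generalizing s n with
  | nil =>
    simp only [jointWeight, weight]
    by_cases hn : n = src.policy.init
    · simp [hn]
    · simp [hn]
  | cons o h ih =>
    simp only [jointWeight, weight]
    rw [sum_sum_sum_rotate]
    refine Finset.sum_congr rfl fun s₁ _ => Finset.sum_congr rfl fun n₁ _ => ?_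
    rw [Finset.sum_comm, ← ih, Finset.sum_mul]
    refine Finset.sum_congr rfl fun l₁ _ => ?_
    rw [← Finset.mul_sum]
    congr 1
    rw [sum_sum_sum_rotate]
    refine Finset.sum_congr rfl fun a _ => ?_
    simp only [← Finset.mul_sum, stdSimplex.sum_eq_one, mul_one, hJ.1, hJ.2]
    simp only [← Finset.sum_mul, ← Finset.mul_sum, stdSimplex.sum_eq_one, mul_one]

lemma jointProb_eq_prob (hJ : J.OneWay src.M) : src.jointProb J p = src.prob := by
  funext h
  simp only [jointProb, prob, src.sum_jointWeight p hJ]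

lemma length_eq_of_info_eq {h h' : List O} (e : src.info p h = src.info p h') :
    h.length = h'.length := by
  simpa [info] using congrArg List.length e

/-- The receiver's conditional expectations depend on its information only. -/
lemma condInfo_congr (F : List O → S → Fin mB → ℝ) {h h' : List O}
    (e : src.info p h = src.info p h') : src.condInfo J p F h = src.condInfo J p F h' := by
  have hl := src.length_eq_of_info_eq p e
  unfold condInfo
  rw [e]
  generalize src.info p h' = i
  rw [hl]

lemma receiverIntent_congr {h h' : List O} (e : src.info p h = src.info p h') :
    src.receiverIntent J p h = src.receiverIntent J p h' := by
  simp only [receiverIntent, src.condInfo_congr p _ e]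

lemma receiverIntent_belief_mem_stdSimplex (hJ : J.OneWay src.M) {h : List O}
    (hr : src.Reachable h) : (src.receiverIntent J p h).belief ∈ stdSimplex ℝ S := by
  classical
  have hlaw : IsHistoryLaw (src.jointProb J p) := by
    rw [src.jointProb_eq_prob p hJ]
    exact src.isHistoryLaw_prob
  have hpos : 0 < eventProb (src.jointProb J p) h.length
      (fun g => src.info p g = src.info p h) :=
    eventProb_self_pos hlaw (src.info p) rfl (by rwa [src.jointProb_eq_prob p hJ])
  refine ⟨fun s => div_nonneg (Finset.sum_nonneg fun ω _ => ?_) hpos.le, ?_⟩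
  · split_ifs
    · refine Finset.sum_nonneg fun s₁ _ => Finset.sum_nonneg fun n₁ _ =>
        Finset.sum_nonneg fun l₁ _ => mul_nonneg (src.jointWeight_nonneg p _ _ _ _) ?_
      dsimp only
      split_ifs <;> norm_num
    · exact le_rfl
  · simp only [receiverIntent, condInfo]
    rw [← Finset.sum_div, div_eq_one_iff_eq hpos.ne', Finset.sum_comm, eventProb]
    refine Finset.sum_congr rfl fun ω _ => ?_
    split_ifs
    · rw [jointProb]
      rw [Finset.sum_comm]
      refine Finset.sum_congr rfl fun s _ => ?_
      rw [sum_sum_sum_rotate]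
      simp
    · simp

end Receiver

end Source

/-! ### Chain rules for traces -/

section Chain

variable {O X Y : Type}

lemma trace_eq_iff {T : ℕ} {h h' : List O} (hT : h.length = T + 1) (hT' : h'.length = T + 1)
    (f : List O → X) :
    trace f h = trace f h' ↔ f h = f h' ∧ trace f h.tail = trace f h'.tail := by
  cases h with
  | nil => simp at hT
  | cons o h => cases h' with
    | nil => simp at hT'
    | cons o' h' => simp [trace]

lemma trace_prod (f : List O → X) (g : List O → Y) (h : List O) :
    trace (fun k => (f k, g k)) h = (trace f h).zip (trace g h) := by
  induction h with
  | nil => rfl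
  | cons o h ih => simp [trace, ih]

variable [Fintype O] {p : List O → ℝ}

lemma entropy_zero_horizon (hp : IsHistoryLaw p) (f : List O → X) : entropy p 0 f = 0 := by
  rw [entropy_congr hp (g := fun _ => ()) fun h h' h0 h0' => ?_, entropy_const hp]
  rw [List.length_eq_zero_iff.1 h0, List.length_eq_zero_iff.1 h0']
  simp

lemma entropy_trace_le_mul (hp : IsHistoryLaw p) {f : List O → X} {T : ℕ} {R : ℝ}
    (hR : ∀ t ∈ Finset.Icc 1 T, condEntropy p t f (fun h => trace f h.tail) ≤ R) :
    entropy p T (trace f) ≤ T * R := by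
  induction T with
  | zero => simp [entropy_zero_horizon hp]
  | succ T ih =>
    have h1 := ih fun t ht => hR t (Finset.mem_Icc.2
      ⟨(Finset.mem_Icc.1 ht).1, (Finset.mem_Icc.1 ht).2.trans T.le_succ⟩)
    have h2 := hR (T + 1) (Finset.mem_Icc.2 ⟨by omega, le_rfl⟩)
    rw [condEntropy, entropy_tail hp T (trace f),
      entropy_congr hp (f := fun h => (f h, trace f h.tail)) (g := trace f)
        fun h h' hT hT' => by rw [trace_eq_iff hT hT', Prod.mk.injEq]] at h2
    push_cast
    linarith

/-- The conditional entropy of a whole trajectory is at most the sum of the conditional entropies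
of its values, each given the side information up to its own time. -/
lemma condEntropy_trace_le_sum (hp : IsHistoryLaw p) (f : List O → X) (g : List O → Y) (T : ℕ) :
    condEntropy p T (trace f) (trace g) ≤
      ∑ t ∈ Finset.Icc 1 T, condEntropy p t f (trace g) := by
  induction T with
  | zero => simp [condEntropy, entropy_zero_horizon hp]
  | succ T ih =>
    rw [Finset.sum_Icc_succ_top (by omega)]
    have h1 := condEntropy_prod_le hp (T + 1) f (fun h => trace f h.tail) (trace g)
    have h2 := condEntropy_prod_le hp (T + 1) (fun h => trace f h.tail) g
      (fun h => trace g h.tail)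
    simp only [condEntropy] at *
    rw [entropy_congr hp (f := fun h => (f h, trace f h.tail, trace g h))
      (g := fun h => (trace f h, trace g h)) fun h h' hT hT' => by
        simp only [Prod.mk.injEq, trace_eq_iff hT hT' f, and_assoc]] at h1
    rw [entropy_congr hp (f := fun h => (trace f h.tail, g h, trace g h.tail))
      (g := fun h => (trace f h.tail, trace g h)) fun h h' hT hT' => by
        simp only [Prod.mk.injEq, trace_eq_iff hT hT' g],
      entropy_congr hp (f := fun h => (g h, trace g h.tail)) (g := trace g) fun h h' hT hT' => by
        simp only [Prod.mk.injEq, trace_eq_iff hT hT' g],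
      entropy_tail hp T (fun h => (trace f h, trace g h)), entropy_tail hp T (trace g)] at h2
    linarith

end Chain

lemma binEntropy₂_eq (θ : ℝ) :
    binEntropy₂ θ = -(θ * Real.logb 2 θ) - (1 - θ) * Real.logb 2 (1 - θ) := by
  rw [binEntropy₂, Real.binEntropy, Real.log_inv, Real.log_inv, Real.logb, Real.logb]
  ring

namespace Source

variable {S A O : Type} [Fintype S] [Fintype A] [Fintype O] (src : Source S A O)

/-! ### Entropy rates of the quotient processes -/

/-- A process obtained by projecting the pair of quotient processes to a finite alphabet has an
entropy rate. -/
lemma exists_tendsto_of_regular {mA mB : ℕ} (hreg : src.Regular mA mB) {X : Type}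
    (φ : src.QClass mA × src.QClass mB → X) {𝒜 : Finset X}
    (h𝒜 : ∀ h, src.Reachable h → φ (src.cls mA h, src.cls mB h) ∈ 𝒜) :
    ∃ r, Tendsto (fun T : ℕ =>
      entropy src.prob T (trace fun h => φ (src.cls mA h, src.cls mB h)) / T) atTop (𝓝 r) := by
  obtain ⟨μ, -, -, δ, hδ, hμ⟩ := hreg
  refine exists_tendsto_entropy_div src.isHistoryLaw_prob h𝒜 hδ
    (ν := fun k B => (μ {x | ((List.ofFn fun i : Fin k => x i).map φ).reverse ∈ B}).toReal)
    fun t k B => ?_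
  have h := hμ t k {l | (l.map φ).reverse ∈ B}
  simp only [Set.mem_ofPred_eq, List.map_reverse, List.reverse_reverse, List.map_take,
    map_trace] at h
  exact h

lemma exists_hasEntropyRate {mA mB : ℕ} (hm : mB ≤ mA) (hfin : (src.alphabet mA).Finite)
    (hreg : src.Regular mA mB) :
    ∃ hA hB : ℝ, src.HasEntropyRate mA hA ∧ src.HasEntropyRate mB hB := by
  obtain ⟨hA, h1⟩ := src.exists_tendsto_of_regular hreg Prod.fst (𝒜 := hfin.toFinset)
    fun h hr => hfin.mem_toFinset.2 ⟨h, hr, rfl⟩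
  obtain ⟨hB, h2⟩ := src.exists_tendsto_of_regular hreg Prod.snd
    (𝒜 := (src.alphabet_finite_of_le hm hfin).toFinset)
    fun h hr => (src.alphabet_finite_of_le hm hfin).mem_toFinset.2 ⟨h, hr, rfl⟩
  exact ⟨hA, hB, h1, h2⟩

/-! ### Decoding the sender's class -/

section Decoding

variable {J : TwoAgentKernels S A O} {K mA mB : ℕ} (p : Protocol K mB (src.QClass mB) A O)

lemma cls_eq_of_info_eq {h h' : List O} (e : src.info p h = src.info p h') :
    src.cls mB h = src.cls mB h' := by
  cases h with
  | nil => cases h' with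
    | nil => rfl
    | cons o' h' => simp [info, trace] at e
  | cons o h => cases h' with
    | nil => simp [info, trace] at e
    | cons o' h' =>
      simp only [info, trace, List.cons.injEq, Prod.mk.injEq] at e
      exact e.1.2

variable [MetricSpace S]

variable (J mA) in
open Classical in
/-- The estimate of the sender's class from the receiver's information `i`: the class of a reachable
history that is compatible with the receiver's class and whose intent is within half the separation
constant of the receiver's intent, if there is one. -/
noncomputable def guess (i : List (Fin K × src.QClass mB)) : src.QClass mA :=
  if H : ∃ g, ∃ h, src.Reachable g ∧ src.cls mB g = src.cls mB h ∧ src.info p h = i ∧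
      2 * ENNReal.ofReal (dIntent (src.intent g) (src.receiverIntent J p h)) < src.cM mA mB
  then src.cls mA H.choose else src.cls mA []

/-- Two compatible histories that are both close to the receiver's intent are closer to each other
than the separation constant, so that the sender does not distinguish them. -/
lemma guess_eq (hJ : J.OneWay src.M) {h : List O} (hr : src.Reachable h)
    (hd : 2 * ENNReal.ofReal (dIntent (src.intent h) (src.receiverIntent J p h)) <
      src.cM mA mB) : src.guess J mA p (src.info p h) = src.cls mA h := by
  classical
  have H : ∃ g, ∃ h', src.Reachable g ∧ src.cls mB g = src.cls mB h' ∧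
      src.info p h' = src.info p h ∧
      2 * ENNReal.ofReal (dIntent (src.intent g) (src.receiverIntent J p h')) < src.cM mA mB :=
    ⟨h, h, hr, rfl, rfl, hd⟩
  rw [guess, dif_pos H]
  obtain ⟨h', hg, hB, hi, hd'⟩ := H.choose_spec
  set g := H.choose
  rw [src.receiverIntent_congr p hi] at hd'
  rw [src.cls_eq_of_info_eq p hi] at hB
  by_contra hne
  have h1 : src.cM mA mB ≤ ENNReal.ofReal (dIntent (src.intent g) (src.intent h)) :=
    iInf_le_of_le g <| iInf_le_of_le h <| iInf_le_of_le hg <| iInf_le_of_le hr <|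
      iInf_le_of_le hne <| iInf_le _ hB
  have h2 := dIntent_triangle (i := src.intent g) (j := src.receiverIntent J p h)
    (k := src.intent h) (src.belief_mem_stdSimplex hg)
    (src.receiverIntent_belief_mem_stdSimplex p hJ hr) (src.belief_mem_stdSimplex hr)
  rw [dIntent_comm (src.receiverIntent J p h)] at h2
  have h3 := (h1.trans (ENNReal.ofReal_le_ofReal h2)).trans ENNReal.ofReal_add_le
  refine (ENNReal.add_lt_add hd' hd).not_ge ?_
  rw [← mul_add, ← two_mul]
  gcongr

/-- Markov's inequality: a wrong estimate costs a distortion of at least half the separation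
constant. -/
lemma eventProb_guess_ne_le (hJ : J.OneWay src.M) (hc : 0 < src.cM mA mB) (t : ℕ) :
    eventProb src.prob t (fun h => src.cls mA h ≠ src.guess J mA p (src.info p h)) ≤
      expect src.prob t (fun h => dIntent (src.intent h) (src.receiverIntent J p h)) *
        (2 * (src.cM mA mB).toReal⁻¹) := by
  classical
  rw [eventProb_eq_expect, ← expect_mul_const]
  refine expect_mono src.isHistoryLaw_prob fun h _ hr => ?_
  have hd0 := dIntent_nonneg (src.intent h) (src.receiverIntent J p h)
  split_ifs with hne
  · have h1 : src.cM mA mB ≤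
        2 * ENNReal.ofReal (dIntent (src.intent h) (src.receiverIntent J p h)) := by
      by_contra hlt
      exact hne (src.guess_eq p hJ hr (not_le.1 hlt)).symm
    have htop : 2 * ENNReal.ofReal (dIntent (src.intent h) (src.receiverIntent J p h)) ≠ ⊤ :=
      ENNReal.mul_ne_top (by norm_num) ENNReal.ofReal_ne_top
    have h2 := ENNReal.toReal_mono htop h1
    rw [ENNReal.toReal_mul, ENNReal.toReal_ofReal hd0] at h2
    have h3 : 0 < (src.cM mA mB).toReal :=
      ENNReal.toReal_pos hc.ne' (ne_top_of_le_ne_top htop h1)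
    have h4 : (1 : ℝ) ≤ 2 * dIntent (src.intent h) (src.receiverIntent J p h) *
        (src.cM mA mB).toReal⁻¹ := by
      rw [← div_eq_mul_inv, le_div_iff₀ h3, one_mul]
      simpa using h2
    linarith
  · positivity

lemma distortion_eq (hJ : J.OneWay src.M) (T : ℕ) :
    src.distortion J p T = (∑ t ∈ Finset.Icc 1 T, expect src.prob t
      (fun h => dIntent (src.intent h) (src.receiverIntent J p h))) / T := by
  rw [distortion, src.jointProb_eq_prob p hJ]
  rfl

/-- For `c_M = ∞` both sides vanish, since `(⊤ : ℝ≥0∞).toReal = 0`. -/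
lemma toReal_epsPrime {ε : ℝ} (hε : 0 ≤ ε) :
    (src.epsPrime mA mB ε).toReal = ε * (2 * (src.cM mA mB).toReal⁻¹) := by
  rw [epsPrime, ENNReal.toReal_div, ENNReal.toReal_mul, ENNReal.toReal_ofReal hε]
  simp only [ENNReal.toReal_ofNat]
  ring

/-- The converse at a finite horizon. -/
lemma blockEntropy_sub_div_le (hfin : (src.alphabet mA).Finite)
    (hintent : src.IntentMeasurable mA) (hJ : J.OneWay src.M) {T : ℕ} (hT : 1 ≤ T) {R ε : ℝ}
    (hR : src.HasRate J p T R) (hε : src.distortion J p T ≤ ε)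
    (hε' : src.epsPrime mA mB ε ≤ 1 / 2) :
    (src.blockEntropy mA T - src.blockEntropy mB T) / T - binEntropy₂ (src.epsPrime mA mB ε).toReal
      - (src.epsPrime mA mB ε).toReal * Real.logb 2 (src.alphabet mA).ncard ≤ R := by
  classical
  have hp := src.isHistoryLaw_prob
  have hT0 : (0 : ℝ) < T := by exact_mod_cast hT
  have hc := src.cM_pos (mB := mB) hfin hintent
  set d : List O → ℝ := fun h => dIntent (src.intent h) (src.receiverIntent J p h) with hd
  set e : ℕ → ℝ := fun t => eventProb src.prob t
    (fun h => src.cls mA h ≠ src.guess J mA p (src.info p h)) with he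
  set θ : ℝ := (src.epsPrime mA mB ε).toReal with hθ
  set N : ℝ := ((src.alphabet mA).ncard : ℝ) with hN
  rw [src.distortion_eq p hJ] at hε
  have hε0 : 0 ≤ ε := le_trans (div_nonneg (Finset.sum_nonneg fun t _ =>
    expect_nonneg hp fun h _ _ => dIntent_nonneg _ _) hT0.le) hε
  have hθ0 : 0 ≤ θ := ENNReal.toReal_nonneg
  have hθ1 : θ ≤ 1 / 2 := by
    have := ENNReal.toReal_mono (by simp) hε'
    simpa using this
  have he0 : ∀ t, 0 ≤ e t := fun t => eventProb_nonneg hp _ _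
  have hesum : ∑ t ∈ Finset.Icc 1 T, e t ≤ T * θ := by
    rw [div_le_iff₀ hT0] at hε
    calc ∑ t ∈ Finset.Icc 1 T, e t
        ≤ ∑ t ∈ Finset.Icc 1 T, expect src.prob t d * (2 * (src.cM mA mB).toReal⁻¹) :=
          Finset.sum_le_sum fun t _ => src.eventProb_guess_ne_le p hJ hc t
      _ = (∑ t ∈ Finset.Icc 1 T, expect src.prob t d) * (2 * (src.cM mA mB).toReal⁻¹) := by
          rw [Finset.sum_mul]
      _ ≤ (ε * T) * (2 * (src.cM mA mB).toReal⁻¹) := by gcongr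
      _ = T * θ := by
          rw [hθ, src.toReal_epsPrime hε0]
          ring
  have hmem : ∀ h, src.Reachable h → src.cls mA h ∈ hfin.toFinset := fun h hr =>
    hfin.mem_toFinset.2 ⟨h, hr, rfl⟩
  have hcard : (hfin.toFinset.card : ℝ) = N := by rw [hN, Set.ncard_eq_toFinset_card _ hfin]
  have hNlog : 0 ≤ Real.logb 2 N := by
    rw [← hcard]
    exact div_nonneg (Real.log_natCast_nonneg _) (Real.log_nonneg (by norm_num))
  -- Fano's inequality at each time, with the common parameter `θ`.
  have hfano : ∀ t ∈ Finset.Icc 1 T, condEntropy src.prob t (src.cls mA) (src.info p) ≤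
      -Real.logb 2 (1 - θ) + e t * (Real.logb 2 (1 - θ) - Real.logb 2 θ + Real.logb 2 N) := by
    intro t ht
    have := condEntropy_le_fano (T := t) hp (fun h _ hr => hmem h hr) (g := src.info p)
      (src.guess J mA p) hθ0 (by linarith) fun h0 => le_antisymm ?_ (eventProb_nonneg hp _ _)
    · rwa [hcard] at this
    · rw [h0, mul_zero] at hesum
      exact (Finset.single_le_sum (fun t _ => he0 t) ht).trans hesum
  have hcoef : 0 ≤ Real.logb 2 (1 - θ) - Real.logb 2 θ + Real.logb 2 N := by
    rcases hθ0.eq_or_lt with h0 | h0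
    · rw [← h0]
      simpa using hNlog
    · have := Real.logb_le_logb_of_le (b := 2) (by norm_num) h0 (by linarith : θ ≤ 1 - θ)
      linarith
  have h1 : condEntropy src.prob T (trace (src.cls mA)) (src.info p) ≤
      T * (binEntropy₂ θ + θ * Real.logb 2 N) := by
    calc _ ≤ ∑ t ∈ Finset.Icc 1 T, condEntropy src.prob t (src.cls mA) (src.info p) :=
          condEntropy_trace_le_sum hp _ _ T
      _ ≤ _ := Finset.sum_le_sum hfano
      _ = T * -Real.logb 2 (1 - θ) + (∑ t ∈ Finset.Icc 1 T, e t) *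
          (Real.logb 2 (1 - θ) - Real.logb 2 θ + Real.logb 2 N) := by
          rw [Finset.sum_add_distrib, Finset.sum_mul, Finset.sum_const, Nat.card_Icc]
          simp
      _ ≤ T * -Real.logb 2 (1 - θ) + T * θ *
          (Real.logb 2 (1 - θ) - Real.logb 2 θ + Real.logb 2 N) := by gcongr
      _ = _ := by
          rw [binEntropy₂_eq]
          ring
  have h2 : src.blockEntropy mA T ≤
      entropy src.prob T (fun h => (trace (src.cls mA) h, src.info p h)) :=
    entropy_le_of_determined hp fun h h' _ _ e => (Prod.mk.inj e).1
  have h3 : entropy src.prob T (src.info p) ≤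
      entropy src.prob T (fun h => (trace p.encoder h, trace (src.cls mB) h)) :=
    entropy_le_of_determined hp fun h h' _ _ e => by
      obtain ⟨e1, e2⟩ := Prod.mk.inj e
      rw [info, info, trace_prod, trace_prod, e1, e2]
  have h4 := entropy_prod_le hp T (trace p.encoder) (trace (src.cls mB))
  have h5 : entropy src.prob T (trace p.encoder) ≤ T * R := by
    refine entropy_trace_le_mul hp fun t ht => ?_
    rw [← src.jointProb_eq_prob p hJ]
    exact hR t ht
  have h6 : src.blockEntropy mA T - src.blockEntropy mB T ≤
      (R + (binEntropy₂ θ + θ * Real.logb 2 N)) * T := by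
    rw [condEntropy] at h1
    simp only [blockEntropy] at h2 ⊢
    linarith
  rw [← div_le_iff₀ hT0] at h6
  linarith

end Decoding

end Source

end SemComm

open SemComm
theorem theorem6p1 {S A O : Type} [Fintype S] [MetricSpace S] [Fintype A] [Fintype O]
    (src : Source S A O) (J : TwoAgentKernels S A O) (mA mB : ℕ)
    (hm : mB ≤ mA) (hsender : src.nodes ≤ mA)
    (hfin : (src.alphabet mA).Finite)
    (hintent : src.IntentMeasurable mA)
    (hreg : src.Regular mA mB)
    (honeway : J.OneWay src.M) :
    ∃ hA hB : ℝ, src.HasEntropyRate mA hA ∧ src.HasEntropyRate mB hB ∧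
      (∃ δ : ℕ → ℝ, Tendsto δ atTop (𝓝 0) ∧
        ∀ (T : ℕ), 1 ≤ T → ∀ (K : ℕ) (p : Protocol K mB (src.QClass mB) A O) (R ε : ℝ),
          src.HasRate J p T R → src.distortion J p T ≤ ε →
          (T : ℝ≥0∞) * src.epsPrime mA mB ε ≤ 1 / 2 →
          (hA - hB) - binEntropy₂ (src.epsPrime mA mB ε).toReal
            - (src.epsPrime mA mB ε).toReal * Real.logb 2 (src.alphabet mA).ncard - δ T ≤ R) ∧
      (∀ (T K : ℕ → ℕ) (p : ∀ k, Protocol (K k) mB (src.QClass mB) A O) (R ε : ℕ → ℝ),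
        Tendsto T atTop atTop →
        (∀ k, src.HasRate J (p k) (T k) (R k)) →
        (∀ k, src.distortion J (p k) (T k) ≤ ε k) →
        Tendsto (fun k => src.epsPrime mA mB (ε k)) atTop (𝓝 0) →
        ((hA - hB : ℝ) : EReal) ≤ liminf (fun k => (R k : EReal)) atTop) ∧
      (∀ η : ℝ, |hA - Real.logb 2 (src.alphabet mA).ncard| ≤ η →
        |hB - Real.logb 2 (src.alphabet mB).ncard| ≤ η →
        |(hA - hB) - (Real.logb 2 (src.alphabet mA).ncard
          - Real.logb 2 (src.alphabet mB).ncard)| ≤ 2 * η) := by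
  obtain ⟨hA, hB, hrA, hrB⟩ := src.exists_hasEntropyRate hm hfin hreg
  have hdiff : Tendsto (fun T : ℕ => (src.blockEntropy mA T - src.blockEntropy mB T) / T) atTop
      (𝓝 (hA - hB)) := by
    simp only [sub_div]
    exact hrA.sub hrB
  refine ⟨hA, hB, hrA, hrB,
    ⟨fun T => (hA - hB) - (src.blockEntropy mA T - src.blockEntropy mB T) / T, ?_, ?_⟩, ?_, ?_⟩
  · simpa using hdiff.const_sub (hA - hB)
  · intro T hT K p R ε hR hε hTε
    have hε' : src.epsPrime mA mB ε ≤ 1 / 2 :=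
      (le_mul_of_one_le_left' (by exact_mod_cast hT)).trans hTε
    have := src.blockEntropy_sub_div_le p hfin hintent honeway hT hR hε hε'
    linarith
  · intro T K p R ε hT hR hε hε'
    set θ : ℕ → ℝ := fun k => (src.epsPrime mA mB (ε k)).toReal with hθdef
    have hθ : Tendsto θ atTop (𝓝 0) := by
      have := (ENNReal.tendsto_toReal ENNReal.zero_ne_top).comp hε'
      rwa [ENNReal.toReal_zero] at this
    have hbin : Tendsto (fun k => binEntropy₂ (θ k)) atTop (𝓝 0) := by
      have := ((Real.binEntropy_continuous.tendsto 0).comp hθ).div_const (Real.log 2)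
      simpa [binEntropy₂] using this
    have hlow : Tendsto (fun k => (src.blockEntropy mA (T k) - src.blockEntropy mB (T k)) / T k
        - binEntropy₂ (θ k) - θ k * Real.logb 2 (src.alphabet mA).ncard) atTop
        (𝓝 (hA - hB)) := by
      simpa using ((hdiff.comp hT).sub hbin).sub
        (hθ.mul_const (Real.logb 2 (src.alphabet mA).ncard))
    rw [← ((continuous_coe_real_ereal.tendsto _).comp hlow).liminf_eq]
    refine liminf_le_liminf ?_
    filter_upwards [hT.eventually_ge_atTop 1,
      hε'.eventually (ge_mem_nhds (show (0 : ℝ≥0∞) < 1 / 2 by simp))] with k hk1 hk2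
    exact EReal.coe_le_coe_iff.2
      (src.blockEntropy_sub_div_le (p k) hfin hintent honeway hk1 (hR k) (hε k) hk2)
  · intro η h1 h2
    rw [abs_le] at *
    constructor <;> linarith
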